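/- **Setting.** Let $\mathbb D$ be the open unit disc. For a matrix-valued (or scalar) non-negative definite kernel $k$ on $\mathbb D$, let $\mathcal H_k$ be the Hilbert space of vector-valued functions on $\mathbb D$ with reproducing kernel $k$, and let multiplication by the coordinate on $\mathcal H_k$ be $(Mf)(z)=zf(z)$. Powers of numbers with positive real part are principal powers. A bounded operator $T$ on a complex separable Hilbert space $\mathcal H$ is in the Cowen–Douglas class $\mathrm B_n(\mathbb D)$, $n\ge 1$, if $\operatorname{ran}(T-w)$ is closed and $\dim\ker(T-w)=n$ for every $w\in\mathbb D$, and $\bigcup_{w\in\mathbb D}\ker(T-w)$ spans a dense subspace of $\mathcal H$. $T$ is homogeneous if $\varphi(T)=e^{i\theta}(T-a)(1-\bar aT)^{-1}$ is unitarily equivalent to $T$ for every Möbius map $\varphi(z)=e^{i\theta}\frac{z-a}{1-\bar az}$ ($\theta\in\mathbb R$, $|a|<1$) that is analytic on the spectrum of $T$. $T$ is reducible if some closed subspace $N\neq 0,\mathcal H$ satisfies $TN\subseteq N$ and $TN^\perp\subseteq N^\perp$; otherwise (and if $\mathcal H\ne0$) it is irreducible. For a kernel $K$ on $\mathbb D^3$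 put $$J^{(1,1)}K=\begin{pmatrix}K&\partial_2K&\partial_3K\\ \bar\partial_2K&\partial_2\bar\partial_2K&\bar\partial_2\partial_3K\\ \bar\partial_3K&\partial_2\bar\partial_3K&\bar\partial_3\partial_3K\end{pmatrix},$$ where $\partial_i$ acts on the $i$-th coordinate of the first variable $z$ and $\bar\partial_i$ on the $i$-th coordinate of the second variable $w$. For a kernel $B$ on $\mathbb D^2$ put $J^{(2)}B=\big(\partial_2^i\bar\partial_2^jB\big)_{i,j=0,1}$. For $\alpha,\beta,\gamma>0$, let $G$ be the $3\times 3$ matrix kernel on $\mathbb D$ obtained by restricting $(J^{(1,1)}K)^t$ to the diagonal $\{(z,z,z):z\in\mathbb D\}$, where $$K(z,w)=(1-z_1\bar w_1)^{-\alpha}(1-z_2\bar w_2)^{-\beta}(1-z_3\bar w_3)^{-\gamma}.$$ For $a,b>0$, let $M^{(a,b)}$ be multiplication by the coordinate on the Hilbert space whose reproducing kernel is the $2\times 2$ matrix kernel on $\mathbb D$ obtained by restricting $J^{(2)}B^{(a,b)}$ to $\{(z,z):z\in\mathbb D\}$, where $B^{(a,b)}(z,w)=(1-z_1\bar w_1)^{-a}(1-z_2\bar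 w_2)^{-b}$. **Theorem.** Let $\alpha,\beta,\gamma>0$. The kernel $G$, the restricted kernel $J^{(2)}B^{(\alpha,\beta+\gamma)}$ and the scalar kernel $(1-z\bar w)^{-\alpha-\beta-\gamma-2}$ on $\mathbb D$ are non-negative definite, and the Hilbert spaces with these reproducing kernels consist of holomorphic functions ($\mathbb C^3$-, $\mathbb C^2$- and $\mathbb C$-valued respectively) on $\mathbb D$. The operators of multiplication by the coordinate on them, $M$, $M_1=M^{(\alpha,\beta+\gamma)}$ and $M_2$ respectively, are well defined and bounded. Moreover: 1. $M^*$ is in $\mathrm B_3(\mathbb D)$, is homogeneous, and is reducible. 2. $M^*$ is unitarily equivalent to $M_1^*\oplus M_2^*$. 3. $M_1^*$ is irreducible, homogeneous, and in $\mathrm B_2(\mathbb D)$. 4. $M_2^*$ is irreducible, homogeneous, and in $\mathrm B_1(\mathbb D)$. -/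

import Mathlib

open Complex ComplexConjugate
open scoped ComplexOrder Complex.UnitDisc

noncomputable section

/-! ### Bounded operators on Hilbert spaces -/

section Operators

variable {H : Type*} [NormedAddCommGroup H] [InnerProductSpace ℂ H]
variable {H' : Type*} [NormedAddCommGroup H'] [InnerProductSpace ℂ H']

/-- Unitary equivalence of bounded operators: `U T = S U` for some unitary `U : H → H'`. -/
def UnitarilyEquivalent (T : H →L[ℂ] H) (S : H' →L[ℂ] H') : Prop :=
  ∃ U : H ≃ₗᵢ[ℂ] H', ∀ x, U (T x) = S (U x)

/-- The orthogonal direct sum `T ⊕ S` on the Hilbert space direct sum `H ⊕ H'`. -/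
def directSumOp (T : H →L[ℂ] H) (S : H' →L[ℂ] H') :
    WithLp 2 (H × H') →L[ℂ] WithLp 2 (H × H') :=
  (WithLp.prodContinuousLinearEquiv 2 ℂ H H').symm.toContinuousLinearMap ∘L
    (T.prodMap S) ∘L (WithLp.prodContinuousLinearEquiv 2 ℂ H H').toContinuousLinearMap

/-- `T` is reducible: it is the direct sum of its restrictions to a closed subspace
`N ≠ 0, H` and to the orthogonal complement of `N`. -/
def IsReducibleOp (T : H →L[ℂ] H) : Prop :=
  ∃ N : Submodule ℂ H, IsClosed (N : Set H) ∧ N ≠ ⊥ ∧ N ≠ ⊤ ∧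
    (∀ x ∈ N, T x ∈ N) ∧ (∀ x ∈ Nᗮ, T x ∈ Nᗮ)

/-- `T` is irreducible: it acts on a nonzero space and is not reducible. -/
def IsIrreducibleOp (T : H →L[ℂ] H) : Prop :=
  Nontrivial H ∧ ¬ IsReducibleOp T

/-- `φ(T) = e^{iθ} (T - a) (1 - ā T)⁻¹`, for the Möbius map
`φ(z) = e^{iθ} (z - a) / (1 - ā z)`. -/
def mobiusOp (θ : ℝ) (a : ℂ) (T : H →L[ℂ] H) : H →L[ℂ] H :=
  exp (θ * I) • ((T - a • 1) * Ring.inverse (1 - conj a • T))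

/-- `T` is homogeneous: `φ(T)` is unitarily equivalent to `T` for every biholomorphic
automorphism `φ(z) = e^{iθ} (z - a) / (1 - ā z)`, `|a| < 1`, of the unit disc which is analytic
on the spectrum of `T`, that is, whose denominator has no zero on the spectrum. -/
def IsHomogeneousOp (T : H →L[ℂ] H) : Prop :=
  ∀ (θ : ℝ) (a : ℂ), ‖a‖ < 1 → (∀ w ∈ spectrum ℂ T, 1 - conj a * w ≠ 0) →
    UnitarilyEquivalent (mobiusOp θ a T) T

/-- The Cowen–Douglas class `B_n(Ω)`, for a single operator on a separable Hilbert space. -/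
structure CowenDouglas (n : ℕ) (Ω : Set ℂ) (T : H →L[ℂ] H) : Prop where
  pos : 0 < n
  separable : TopologicalSpace.SeparableSpace H
  isClosed_range : ∀ w ∈ Ω, IsClosed (Set.range fun x => T x - w • x)
  dense_span : (Submodule.span ℂ {x : H | ∃ w ∈ Ω, T x = w • x}).topologicalClosure = ⊤
  finrank_ker : ∀ w ∈ Ω, Module.finrank ℂ (Module.End.eigenspace (T : H →ₗ[ℂ] H) w) = n

end Operators

/-! ### Derivatives of kernels and the jet construction -/

/-- The Wirtinger derivative `∂f = (∂ₓ f - i ∂_y f) / 2`. -/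
def wirtinger (f : ℂ → ℂ) (z : ℂ) : ℂ :=
  (1 / 2) * (fderiv ℝ f z 1 - I * fderiv ℝ f z I)

/-- The Wirtinger derivative `∂̄f = (∂ₓ f + i ∂_y f) / 2`. -/
def wirtingerBar (f : ℂ → ℂ) (z : ℂ) : ℂ :=
  (1 / 2) * (fderiv ℝ f z 1 + I * fderiv ℝ f z I)

/-- `∂_i K (z, w)`, the derivative in the `i`-th coordinate of the first variable `z`. -/
def kernelD {m : ℕ} (i : Fin m) (K : (Fin m → ℂ) → (Fin m → ℂ) → ℂ) (z w : Fin m → ℂ) : ℂ :=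
  wirtinger (fun t => K (Function.update z i t) w) (z i)

/-- `∂̄_i K (z, w)`, the conjugate derivative in the `i`-th coordinate of the second
variable `w`. -/
def kernelDBar {m : ℕ} (i : Fin m) (K : (Fin m → ℂ) → (Fin m → ℂ) → ℂ) (z w : Fin m → ℂ) : ℂ :=
  wirtingerBar (fun t => K z (Function.update w i t)) (w i)

/-- The jet `J^{(1,1)} K` of a kernel on the tridisc. Coordinates are numbered from `0`, so that
`kernelD 1` is `∂₂` and `kernelD 2` is `∂₃`. -/
def jetOneOne (K : (Fin 3 → ℂ) → (Fin 3 → ℂ) → ℂ) (z w : Fin 3 → ℂ) : Matrix (Fin 3) (Fin 3) ℂ :=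
  !![K z w, kernelD 1 K z w, kernelD 2 K z w;
     kernelDBar 1 K z w, kernelD 1 (kernelDBar 1 K) z w, kernelDBar 1 (kernelD 2 K) z w;
     kernelDBar 2 K z w, kernelD 1 (kernelDBar 2 K) z w, kernelDBar 2 (kernelD 2 K) z w]

/-- The jet kernel `J^{(k)} K = (∂₂^i ∂̄₂^j K)_{0 ≤ i, j < k}` of a kernel on the bidisc. -/
def jetKernel (k : ℕ) (K : (Fin 2 → ℂ) → (Fin 2 → ℂ) → ℂ) (z w : Fin 2 → ℂ) :
    Matrix (Fin k) (Fin k) ℂ :=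
  Matrix.of fun i j => (kernelD 1)^[(i : ℕ)] ((kernelDBar 1)^[(j : ℕ)] K) z w

/-- The kernel `∏ᵢ (1 - zᵢ w̄ᵢ)^{-aᵢ}` on the polydisc. There every `1 - zᵢ w̄ᵢ` has positive
real part, and the power is the principal one. -/
def polydiscKernel {m : ℕ} (a : Fin m → ℝ) (z w : Fin m → ℂ) : ℂ :=
  ∏ i, (1 - z i * conj (w i)) ^ (-(a i : ℂ))

/-! ### Kernels on the unit disc -/

/-- The restriction of a matrix valued kernel on the polydisc to the diagonal
`{(z, …, z) : z ∈ 𝔻}`, as an operator valued kernel on the disc. -/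
def diagonalKernel {m n : ℕ} (G : (Fin m → ℂ) → (Fin m → ℂ) → Matrix (Fin n) (Fin n) ℂ) :
    Matrix 𝔻 𝔻 (EuclideanSpace ℂ (Fin n) →L[ℂ] EuclideanSpace ℂ (Fin n)) :=
  Matrix.of fun z w => Matrix.toEuclideanCLM (𝕜 := ℂ) (n := Fin n)
    (G (fun _ => (z : ℂ)) (fun _ => (w : ℂ)))

/-- The `3 × 3` kernel `G = (J^{(1,1)} K)ᵗ` on the disc, where
`K(z, w) = (1 - z₁ w̄₁)^{-α} (1 - z₂ w̄₂)^{-β} (1 - z₃ w̄₃)^{-γ}`. -/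
def tridiscJetKernel (α β γ : ℝ) :
    Matrix 𝔻 𝔻 (EuclideanSpace ℂ (Fin 3) →L[ℂ] EuclideanSpace ℂ (Fin 3)) :=
  diagonalKernel fun z w => (jetOneOne (polydiscKernel ![α, β, γ]) z w).transpose

/-- The `2 × 2` kernel `J^{(2)} B^{(α,β)}` on the disc, where
`B^{(α,β)}(z, w) = (1 - z₁ w̄₁)^{-α} (1 - z₂ w̄₂)^{-β}`. The multiplication operator on its
reproducing kernel Hilbert space is `M^{(α,β)}`. -/
def bidiscJetKernel (α β : ℝ) :
    Matrix 𝔻 𝔻 (EuclideanSpace ℂ (Fin 2) →L[ℂ] EuclideanSpace ℂ (Fin 2)) :=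
  diagonalKernel (jetKernel 2 (polydiscKernel ![α, β]))

/-- The scalar kernel `(1 - z w̄)^{-s}` on the disc. -/
def discKernel (s : ℝ) : Matrix 𝔻 𝔻 (ℂ →L[ℂ] ℂ) :=
  Matrix.of fun z w => ((1 - (z : ℂ) * conj (w : ℂ)) ^ (-(s : ℂ))) • (1 : ℂ →L[ℂ] ℂ)

section MultiplicationOperator

variable {V : Type*} [NormedAddCommGroup V] [InnerProductSpace ℂ V]
variable {H : Type*} [NormedAddCommGroup H] [InnerProductSpace ℂ H] [RKHS ℂ H 𝔻 V]

/-- `M` is the operator of multiplication by the coordinate function, `(M f)(z) = z f(z)`. -/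
def IsMulByCoord (M : H →L[ℂ] H) : Prop :=
  ∀ (f : H) (z : 𝔻), (M f) z = (z : ℂ) • f z

variable (H) in
/-- All elements of the function space `H` are holomorphic on the unit disc. -/
def ConsistsOfHolomorphic : Prop :=
  ∀ f : H, ∃ F : ℂ → V, DifferentiableOn ℂ F (Metric.ball 0 1) ∧ ∀ z : 𝔻, F (z : ℂ) = f z

end MultiplicationOperator

end

/-! Everything is read off from factorizations `K(z, w) = k(z)* k(w)` through a Hilbert space in
which the vectors `k(w) v` are total. Two such factorizations of one kernel differ by a unitary
(`KernelModel.exists_linearIsometryEquiv`), and the adjoint of multiplication by the coordinate is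
determined by `k(w) v ↦ w̄ k(w) v`. Hence any concrete model may replace the function space.

The splitting is a weighted variance identity. With `s = 1 - z w̄`, the form of `G` depends on `v₁,
v₂` only through `β v₁ + γ v₂` and through `(β ū₁ v₁ + γ ū₂ v₂) / s²`. Writing the latter with the
mean `(β v₁ + γ v₂) / (β + γ)` and the difference `v₁ - v₂` leaves the bidisc jet kernel with
parameters `α, β + γ` in the mean, plus `βγ / (β + γ)` times `s ^ (-(α + β + γ + 2))` in the
difference (`inner_tridiscJetKernel_eq_add`). The change of coordinates is constant in `z`, so it
gives an orthogonal sum of operators.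

For the summands, completing a square places the bidisc jet kernel in `ℓ² ⊕ ℓ²`, where the operator
is upper triangular with weighted backward shifts on the diagonal (`exists_bidiscBackward`). It is
therefore onto with a kernel of dimension two; the scalar kernel gives a single shift, with kernel
of dimension one.

Homogeneity comes from covariance of the kernels under disc automorphisms, obtained from the
transformation of `log (1 - z w̄)` and its derivatives (`KernelModel.isMobiusInvariant`). Since `T -
w` is `φ(T)` times an invertible operator, surjectivity and the dimension of the kernel pass from
the origin to every point of the disc.

For irreducibility, a reducing projection preserves the eigenspaces, which are the ranges of `k(w)`,
and so becomes a family `p(w)` with `K(z, w) p(w) = p(z)* K(z, w)`. This family is then shown to be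
one scalar (`bidiscJetKernel_commutant`, `discKernel_commutant`). -/

open scoped InnerProductSpace

noncomputable section

/-! ### Unitary equivalence, direct sums and Möbius invariant operators -/

section OperatorTheory

variable {H : Type*} [NormedAddCommGroup H] [InnerProductSpace ℂ H]
variable {H' : Type*} [NormedAddCommGroup H'] [InnerProductSpace ℂ H']
variable {H'' : Type*} [NormedAddCommGroup H''] [InnerProductSpace ℂ H'']

theorem UnitarilyEquivalent.symm {T : H →L[ℂ] H} {S : H' →L[ℂ] H'}
    (h : UnitarilyEquivalent T S) : UnitarilyEquivalent S T := by
  obtain ⟨U, hU⟩ := h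
  exact ⟨U.symm, fun x => by rw [LinearIsometryEquiv.symm_apply_eq, hU]; simp⟩

theorem UnitarilyEquivalent.trans {T : H →L[ℂ] H} {S : H' →L[ℂ] H'} {R : H'' →L[ℂ] H''}
    (h : UnitarilyEquivalent T S) (h' : UnitarilyEquivalent S R) : UnitarilyEquivalent T R := by
  obtain ⟨U, hU⟩ := h
  obtain ⟨W, hW⟩ := h'
  exact ⟨U.trans W, fun x => by simp [hU, hW]⟩

theorem UnitarilyEquivalent.surjective {T : H →L[ℂ] H} {S : H' →L[ℂ] H'}
    (h : UnitarilyEquivalent T S) (hS : Function.Surjective S) : Function.Surjective T := by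
  obtain ⟨U, hU⟩ := h
  intro y
  obtain ⟨x, hx⟩ := hS (U y)
  exact ⟨U.symm x, U.injective (by rw [hU]; simp [hx])⟩

theorem UnitarilyEquivalent.finrank_eigenspace {T : H →L[ℂ] H} {S : H' →L[ℂ] H'}
    (h : UnitarilyEquivalent T S) (w : ℂ) :
    Module.finrank ℂ (Module.End.eigenspace (T : H →ₗ[ℂ] H) w) =
      Module.finrank ℂ (Module.End.eigenspace (S : H' →ₗ[ℂ] H') w) := by
  obtain ⟨U, hU⟩ := h
  have : Module.End.eigenspace (S : H' →ₗ[ℂ] H') w =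
      (Module.End.eigenspace (T : H →ₗ[ℂ] H) w).map (U.toLinearEquiv : H →ₗ[ℂ] H') := by
    ext y
    obtain ⟨x, rfl⟩ := U.surjective y
    simp [← hU, ← map_smul]
  rw [this]
  exact (LinearEquiv.finrank_map_eq U.toLinearEquiv _).symm

@[simp]
theorem directSumOp_apply (T : H →L[ℂ] H) (S : H' →L[ℂ] H') (x : WithLp 2 (H × H')) :
    directSumOp T S x = WithLp.toLp 2 (T x.fst, S x.snd) := rfl

theorem directSumOp_surjective {T : H →L[ℂ] H} {S : H' →L[ℂ] H'}
    (hT : Function.Surjective T) (hS : Function.Surjective S) :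
    Function.Surjective (directSumOp T S) := by
  intro y
  obtain ⟨x, hx⟩ := hT y.fst
  obtain ⟨x', hx'⟩ := hS y.snd
  exact ⟨WithLp.toLp 2 (x, x'), by simp [hx, hx']; rfl⟩

theorem finrank_eigenspace_directSumOp (T : H →L[ℂ] H) (S : H' →L[ℂ] H') (w : ℂ)
    [FiniteDimensional ℂ (Module.End.eigenspace (T : H →ₗ[ℂ] H) w)]
    [FiniteDimensional ℂ (Module.End.eigenspace (S : H' →ₗ[ℂ] H') w)] :
    Module.finrank ℂ (Module.End.eigenspace
      (directSumOp T S : WithLp 2 (H × H') →ₗ[ℂ] WithLp 2 (H × H')) w) =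
      Module.finrank ℂ (Module.End.eigenspace (T : H →ₗ[ℂ] H) w) +
      Module.finrank ℂ (Module.End.eigenspace (S : H' →ₗ[ℂ] H') w) := by
  have hmem (x : WithLp 2 (H × H')) : x ∈ Module.End.eigenspace
      (directSumOp T S : WithLp 2 (H × H') →ₗ[ℂ] WithLp 2 (H × H')) w ↔
      x.fst ∈ Module.End.eigenspace (T : H →ₗ[ℂ] H) w ∧
        x.snd ∈ Module.End.eigenspace (S : H' →ₗ[ℂ] H') w := by
    simp only [Module.End.mem_eigenspace_iff]
    constructor
    · intro h
      exact ⟨congrArg WithLp.fst h, congrArg WithLp.snd h⟩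
    · rintro ⟨h1, h2⟩
      exact (WithLp.linearEquiv 2 ℂ (H × H')).injective (Prod.ext h1 h2)
  let e : Module.End.eigenspace
      (directSumOp T S : WithLp 2 (H × H') →ₗ[ℂ] WithLp 2 (H × H')) w ≃ₗ[ℂ]
      Module.End.eigenspace (T : H →ₗ[ℂ] H) w × Module.End.eigenspace (S : H' →ₗ[ℂ] H') w :=
    { toFun := fun x => (⟨x.1.fst, ((hmem _).1 x.2).1⟩, ⟨x.1.snd, ((hmem _).1 x.2).2⟩)
      invFun := fun y => ⟨WithLp.toLp 2 (y.1.1, y.2.1), (hmem _).2 ⟨y.1.2, y.2.2⟩⟩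
      map_add' := fun _ _ => rfl
      map_smul' := fun _ _ => rfl
      left_inv := fun _ => rfl
      right_inv := fun _ => rfl }
  rw [e.finrank_eq, Module.finrank_prod]

theorem isReducibleOp_of_unitarilyEquivalent_directSumOp {R : H'' →L[ℂ] H''}
    {T : H →L[ℂ] H} {S : H' →L[ℂ] H'} [Nontrivial H] [Nontrivial H']
    (h : UnitarilyEquivalent R (directSumOp T S)) : IsReducibleOp R := by
  obtain ⟨U, hU⟩ := h
  have hU' (x : H'') (y : WithLp 2 (H × H')) : ⟪x, U.symm y⟫_ℂ = ⟪U x, y⟫_ℂ := by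
    rw [← U.inner_map_map, U.apply_symm_apply]
  -- The reducing subspace is the preimage of the first summand; its orthogonal complement is the
  -- preimage of the second.
  let N : Submodule ℂ H'' :=
    LinearMap.ker (WithLp.sndₗ 2 ℂ H H' ∘ₗ (U.toLinearEquiv : H'' →ₗ[ℂ] WithLp 2 (H × H')))
  have hN (x : H'') : x ∈ N ↔ (U x).snd = 0 := by simp [N]
  have hNo (x : H'') : x ∈ Nᗮ ↔ (U x).fst = 0 := by
    rw [Submodule.mem_orthogonal']
    constructor
    · intro hx
      have := hx (U.symm (WithLp.toLp 2 ((U x).fst, 0))) (by simp [hN])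
      rw [hU', WithLp.prod_inner_apply] at this
      simpa using this
    · intro hx y hy
      rw [← U.inner_map_map, WithLp.prod_inner_apply]
      simp [(hN y).1 hy, hx]
  refine ⟨N, ?_, ?_, ?_, ?_, ?_⟩
  · have : (N : Set H'') = {x | WithLp.sndL 2 ℂ H H' (U x) = 0} := by ext x; exact hN x
    rw [this]
    exact isClosed_eq (by fun_prop) continuous_const
  · obtain ⟨x, hx⟩ := exists_ne (0 : H)
    intro h
    have : U.symm (WithLp.toLp 2 (x, 0)) ∈ N := by simp [hN]
    rw [h, Submodule.mem_bot] at this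
    exact hx (by simpa using this)
  · obtain ⟨x, hx⟩ := exists_ne (0 : H')
    intro h
    have : U.symm (WithLp.toLp 2 (0, x)) ∈ N := by rw [h]; trivial
    exact hx (by simpa [hN] using this)
  · intro x hx
    rw [hN] at hx ⊢
    simp [hU, hx]
  · intro x hx
    rw [hNo] at hx ⊢
    simp [hU, hx]

theorem directSumOp_unitarilyEquivalent {K K' : Type*} [NormedAddCommGroup K]
    [InnerProductSpace ℂ K] [NormedAddCommGroup K'] [InnerProductSpace ℂ K']
    {T : H →L[ℂ] H} {S : H' →L[ℂ] H'} {T' : K →L[ℂ] K} {S' : K' →L[ℂ] K'}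
    (h : UnitarilyEquivalent T T') (h' : UnitarilyEquivalent S S') :
    UnitarilyEquivalent (directSumOp T S) (directSumOp T' S') := by
  obtain ⟨U, hU⟩ := h
  obtain ⟨W, hW⟩ := h'
  refine ⟨LinearIsometryEquiv.withLpProdCongr 2 U W, fun x => ?_⟩
  simp [hU, hW]

/-- `T` is invertible where the Möbius functional calculus needs it, and every `φ(T)` is
unitarily equivalent to `T`. -/
def IsMobiusInvariant (T : H →L[ℂ] H) : Prop :=
  ∀ (θ : ℝ) (a : ℂ), ‖a‖ < 1 → IsUnit (1 - conj a • T) ∧ UnitarilyEquivalent (mobiusOp θ a T) T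

theorem IsMobiusInvariant.isHomogeneousOp {T : H →L[ℂ] H} (h : IsMobiusInvariant T) :
    IsHomogeneousOp T := fun θ a ha _ => (h θ a ha).2

/-- Lets facts about `T` at the point `0` be moved to `w`: up to the invertible factor `1 - w̄ T`,
the operator `T - w` is `φ(T)`, which for a Möbius invariant `T` is a unitary copy of `T`. -/
theorem mobiusOp_zero_apply {T : H →L[ℂ] H} {w : ℂ} (hu : IsUnit (1 - conj w • T)) (x : H) :
    mobiusOp 0 w T ((1 - conj w • T) x) = T x - w • x := by
  have : mobiusOp 0 w T * (1 - conj w • T) = T - w • 1 := by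
    rw [mobiusOp, smul_mul_assoc, mul_assoc, Ring.inverse_mul_cancel _ hu]
    simp
  exact DFunLike.congr_fun this x

theorem IsMobiusInvariant.sub_surjective {T : H →L[ℂ] H} (h : IsMobiusInvariant T)
    (hT : Function.Surjective T) {w : ℂ} (hw : ‖w‖ < 1) :
    Function.Surjective fun x => T x - w • x := by
  obtain ⟨hu, he⟩ := h 0 w hw
  intro y
  obtain ⟨x, hx⟩ := he.surjective hT y
  refine ⟨Ring.inverse (1 - conj w • T) x, ?_⟩
  have hinv : (1 - conj w • T) (Ring.inverse (1 - conj w • T) x) = x :=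
    DFunLike.congr_fun (Ring.mul_inverse_cancel _ hu) x
  show T _ - w • _ = y
  rw [← mobiusOp_zero_apply hu, hinv, hx]

theorem IsMobiusInvariant.finrank_eigenspace {T : H →L[ℂ] H} (h : IsMobiusInvariant T)
    {w : ℂ} (hw : ‖w‖ < 1) :
    Module.finrank ℂ (Module.End.eigenspace (T : H →ₗ[ℂ] H) w) =
      Module.finrank ℂ (Module.End.eigenspace (T : H →ₗ[ℂ] H) 0) := by
  obtain ⟨hu, he⟩ := h 0 w hw
  rw [← he.finrank_eigenspace 0]
  obtain ⟨u, hu'⟩ := id hu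
  let e : H ≃ₗ[ℂ] H := (ContinuousLinearEquiv.unitsEquiv ℂ H u).toLinearEquiv
  have hes (x : H) : e x = (1 - conj w • T) x := by rw [← hu']; rfl
  have : Module.End.eigenspace (mobiusOp 0 w T : H →ₗ[ℂ] H) 0 =
      (Module.End.eigenspace (T : H →ₗ[ℂ] H) w).map (e : H →ₗ[ℂ] H) := by
    ext y
    obtain ⟨x, rfl⟩ := e.surjective y
    rw [Submodule.mem_map_equiv, e.symm_apply_apply, Module.End.mem_eigenspace_iff,
      Module.End.mem_eigenspace_iff, hes]
    rw [ContinuousLinearMap.coe_coe, mobiusOp_zero_apply hu, zero_smul, sub_eq_zero]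
    rfl
  rw [this, LinearEquiv.finrank_map_eq]

end OperatorTheory

/-! ### Factorizations of operator valued kernels and their uniqueness -/

section KernelModels

variable {X V E E' : Type*} [NormedAddCommGroup V] [InnerProductSpace ℂ V]
  [NormedAddCommGroup E] [InnerProductSpace ℂ E]
  [NormedAddCommGroup E'] [InnerProductSpace ℂ E']

/-- A total family `k` of operators into a Hilbert space which factorizes the operator valued
kernel `K` as `K(z, w) = k(z)* k(w)`. -/
structure KernelModel (K : Matrix X X (V →L[ℂ] V)) (k : X → V →L[ℂ] E) : Prop where
  inner_apply : ∀ z w u v, ⟪k z u, k w v⟫_ℂ = ⟪u, K z w v⟫_ℂ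
  total : ∀ x : E, (∀ w v, ⟪k w v, x⟫_ℂ = 0) → x = 0

variable {K : Matrix X X (V →L[ℂ] V)} {k : X → V →L[ℂ] E} {k' : X → V →L[ℂ] E'}

theorem kernelModel_kerFun (H : Type*) [NormedAddCommGroup H] [InnerProductSpace ℂ H]
    [RKHS ℂ H X V] [CompleteSpace H] [CompleteSpace V] :
    KernelModel (RKHS.kernel H) (RKHS.kerFun H) where
  inner_apply z w u v := by
    rw [RKHS.kerFun_inner, RKHS.kerFun_apply]
  total f hf := RKHS.ext fun x => ext_inner_left ℂ fun v => by
    rw [← RKHS.kerFun_inner, hf]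
    simp

theorem KernelModel.span_dense [CompleteSpace E] (h : KernelModel K k) :
    (Submodule.span ℂ {x : E | ∃ w v, k w v = x}).topologicalClosure = ⊤ := by
  rw [Submodule.topologicalClosure_eq_top_iff, Submodule.eq_bot_iff]
  intro x hx
  refine h.total x fun w v => ?_
  exact (Submodule.mem_orthogonal _ _).1 hx _ (Submodule.subset_span ⟨w, v, rfl⟩)

theorem KernelModel.denseRange [CompleteSpace E] (h : KernelModel K k) :
    DenseRange (Finsupp.lsum ℂ fun x => (k x : V →ₗ[ℂ] E)) := by
  have := h.span_dense
  rw [Submodule.topologicalClosure_eq_top_iff, Submodule.eq_bot_iff] at this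
  have h2 : (LinearMap.range (Finsupp.lsum ℂ fun x => (k x : V →ₗ[ℂ] E))).topologicalClosure
      = ⊤ := by
    rw [Submodule.topologicalClosure_eq_top_iff, Submodule.eq_bot_iff]
    intro x hx
    refine h.total x fun w v => (Submodule.mem_orthogonal _ _).1 hx _ ⟨Finsupp.single w v, ?_⟩
    simp
  intro x
  have h3 : x ∈ (LinearMap.range
      (Finsupp.lsum ℂ fun x => (k x : V →ₗ[ℂ] E))).topologicalClosure := by rw [h2]; trivial
  exact h3

theorem KernelModel.ext_clm [CompleteSpace E] (h : KernelModel K k) {S T : E →L[ℂ] E'}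
    (hST : ∀ w v, S (k w v) = T (k w v)) : S = T := by
  refine ContinuousLinearMap.coeFn_injective (h.denseRange.equalizer S.continuous T.continuous ?_)
  ext f
  simp [Finsupp.sum, hST]

theorem KernelModel.norm_sq_lsum (h : KernelModel K k) (f : X →₀ V) :
    (‖Finsupp.lsum ℂ (fun x => (k x : V →ₗ[ℂ] E)) f‖ : ℂ) ^ 2 =
      f.sum fun x v => f.sum fun y w => ⟪v, K x y w⟫_ℂ := by
  refine (inner_self_eq_norm_sq_to_K (𝕜 := ℂ)
    (Finsupp.lsum ℂ (fun x => (k x : V →ₗ[ℂ] E)) f)).symm.trans ?_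
  simp [Finsupp.sum, sum_inner, inner_sum, h.inner_apply, -inner_self_eq_norm_sq_to_K]
  exact Finset.sum_comm

/-- The norm of a finite sum of vectors `k w v` is a quadratic expression in `K` alone, so matching
such sums in the two models is isometric between dense subspaces and extends. -/
theorem KernelModel.exists_linearIsometryEquiv [CompleteSpace E] [CompleteSpace E']
    (h : KernelModel K k) (h' : KernelModel K k') :
    ∃ U : E ≃ₗᵢ[ℂ] E', ∀ w v, U (k w v) = k' w v := by
  have hn (f : X →₀ V) : ‖Finsupp.lsum ℂ (fun x => (k' x : V →ₗ[ℂ] E')) f‖ =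
      ‖Finsupp.lsum ℂ (fun x => (k x : V →ₗ[ℂ] E)) f‖ := by
    have := (h'.norm_sq_lsum f).trans (h.norm_sq_lsum f).symm
    norm_cast at this
    exact (sq_eq_sq₀ (norm_nonneg _) (norm_nonneg _)).1 this
  refine ⟨(LinearEquiv.refl ℂ (X →₀ V)).extendOfIsometry _ _ h.denseRange h'.denseRange hn,
    fun w v => ?_⟩
  have := LinearEquiv.extendOfIsometry_eq (LinearEquiv.refl ℂ (X →₀ V)) _ _ h.denseRange
    h'.denseRange hn (Finsupp.single w v)
  simpa using this

theorem KernelModel.isHermitian [CompleteSpace V] (h : KernelModel K k) : K.IsHermitian := by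
  ext z w v
  refine ext_inner_left ℂ fun u => ?_
  rw [Matrix.conjTranspose_apply, ContinuousLinearMap.star_eq_adjoint,
    ContinuousLinearMap.adjoint_inner_right, ← h.inner_apply, ← inner_conj_symm,
    ← h.inner_apply, inner_conj_symm]

/-- The quadratic form of `K` at a finitely supported `f` is the squared norm of the sum of the
vectors `k x (f x)`. -/
theorem KernelModel.posSemidef [CompleteSpace V] (h : KernelModel K k) : K.PosSemidef := by
  have hiff := (RKHS.posSemidef_tfae (K := K)).out 0 2
  refine hiff.2 ⟨h.isHermitian, fun f => ?_⟩
  have h1 : (f.sum fun x w => f.sum fun x' w' => ⟪K x' x w, w'⟫_ℂ) =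
      ((‖Finsupp.lsum ℂ (fun x => (k x : V →ₗ[ℂ] E)) f‖ ^ 2 : ℝ) : ℂ) := by
    have h2 := congrArg conj (h.norm_sq_lsum f)
    rw [← Complex.ofReal_pow, Complex.conj_ofReal] at h2
    rw [h2, Finsupp.sum_comm]
    simp only [Finsupp.sum, map_sum, inner_conj_symm]
  rw [h1, RCLike.re_to_complex, Complex.ofReal_re]
  positivity

/-- The direct sum of two kernel models, along linear maps `A` and `B` which are jointly onto. -/
theorem KernelModel.directSum {V₁ V₂ : Type*} [NormedAddCommGroup V₁] [InnerProductSpace ℂ V₁]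
    [NormedAddCommGroup V₂] [InnerProductSpace ℂ V₂]
    {K₁ : Matrix X X (V₁ →L[ℂ] V₁)} {K₂ : Matrix X X (V₂ →L[ℂ] V₂)}
    {k₁ : X → V₁ →L[ℂ] E} {k₂ : X → V₂ →L[ℂ] E'} (h₁ : KernelModel K₁ k₁)
    (h₂ : KernelModel K₂ k₂) (A : V →L[ℂ] V₁) (B : V →L[ℂ] V₂)
    (hAB : Function.Surjective fun v => (A v, B v))
    (hK : ∀ z w u v, ⟪u, K z w v⟫_ℂ = ⟪A u, K₁ z w (A v)⟫_ℂ + ⟪B u, K₂ z w (B v)⟫_ℂ) :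
    KernelModel K fun w => ((WithLp.prodContinuousLinearEquiv 2 ℂ E E').symm :
      E × E' →L[ℂ] WithLp 2 (E × E')) ∘L ((k₁ w ∘L A).prod (k₂ w ∘L B)) where
  inner_apply z w u v := by
    rw [hK, ← h₁.inner_apply, ← h₂.inner_apply]
    rfl
  total x hx := by
    have key : ∀ w v, ⟪k₁ w (A v), x.fst⟫_ℂ + ⟪k₂ w (B v), x.snd⟫_ℂ = 0 := hx
    have h1 : x.fst = 0 := h₁.total _ fun w v => by
      obtain ⟨u, hu⟩ := hAB (v, 0)
      simp only [Prod.mk.injEq] at hu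
      simpa [hu] using key w u
    have h2 : x.snd = 0 := h₂.total _ fun w v => by
      obtain ⟨u, hu⟩ := hAB (0, v)
      simp only [Prod.mk.injEq] at hu
      simpa [hu] using key w u
    exact (WithLp.linearEquiv 2 ℂ (E × E')).injective (Prod.ext h1 h2)

end KernelModels

/-! ### Kernels on the disc: automorphisms, homogeneity, the Cowen–Douglas class, irreducibility -/

section DiscKernels

variable {V E : Type*} [NormedAddCommGroup V] [InnerProductSpace ℂ V]
  [NormedAddCommGroup E] [InnerProductSpace ℂ E]

theorem isMulByCoord_adjoint {H : Type*} [NormedAddCommGroup H] [InnerProductSpace ℂ H]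
    [CompleteSpace V] [CompleteSpace H] [RKHS ℂ H 𝔻 V] {T : H →L[ℂ] H}
    (hT : ∀ (w : 𝔻) (v : V), T (RKHS.kerFun H w v) = conj (w : ℂ) • RKHS.kerFun H w v) :
    IsMulByCoord (ContinuousLinearMap.adjoint T) := by
  intro f z
  refine ext_inner_left ℂ fun v => ?_
  rw [← RKHS.kerFun_inner, ContinuousLinearMap.adjoint_inner_right, hT, inner_smul_left,
    RKHS.kerFun_inner, inner_smul_right, Complex.conj_conj]

theorem consistsOfHolomorphic_of_kerFun {H : Type*} [NormedAddCommGroup H]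
    [InnerProductSpace ℂ H] [FiniteDimensional ℂ V] [CompleteSpace V] [CompleteSpace H]
    [RKHS ℂ H 𝔻 V]
    (h : ∀ (f : H) (v : V), ∃ F : ℂ → ℂ, DifferentiableOn ℂ F (Metric.ball 0 1) ∧
      ∀ z : 𝔻, F z = ⟪RKHS.kerFun H z v, f⟫_ℂ) : ConsistsOfHolomorphic H := by
  intro f
  choose F hF hF' using h f
  let b := stdOrthonormalBasis ℂ V
  refine ⟨fun z => ∑ i, F (b i) z • b i, ?_, fun z => ?_⟩
  · exact DifferentiableOn.fun_sum fun i _ => (hF (b i)).smul_const _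
  · simp only [hF', RKHS.kerFun_inner]
    exact b.sum_repr' _

/-- The automorphism `z ↦ u (z - a) / (1 - ā z)` of the unit disc. -/
def discMobius (u a : ℂ) (hu : ‖u‖ = 1) (ha : ‖a‖ < 1) (z : 𝔻) : 𝔻 :=
  UnitDisc.mk (u * (z - a) / (1 - conj a * z)) (by
    have hz := z.norm_lt_one
    have h1 : ‖conj a * z‖ < 1 := by
      rw [norm_mul, RCLike.norm_conj]; nlinarith [norm_nonneg a, norm_nonneg (z : ℂ)]
    have h2 : (1 - conj a * z) ≠ 0 := by
      intro h
      rw [sub_eq_zero] at h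
      rw [← h] at h1
      simp at h1
    rw [norm_div, norm_mul, hu, one_mul, div_lt_one (norm_pos_iff.2 h2)]
    rw [← sq_lt_sq₀ (norm_nonneg _) (norm_nonneg _), Complex.sq_norm, Complex.sq_norm]
    have ha' : normSq a < 1 := by rw [Complex.normSq_eq_norm_sq]; nlinarith [norm_nonneg a]
    have hz' : normSq z < 1 := z.normSq_lt_one
    simp only [normSq_apply, sub_re, sub_im, mul_re, mul_im, conj_re, conj_im, one_re,
      one_im] at *
    nlinarith)

theorem one_sub_conj_mul_ne_zero {a z : ℂ} (ha : ‖a‖ < 1) (hz : ‖z‖ < 1) :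
    1 - conj a * z ≠ 0 := by
  intro h
  rw [sub_eq_zero] at h
  have h1 : ‖conj a * z‖ < 1 := by
    rw [norm_mul, RCLike.norm_conj]; nlinarith [norm_nonneg a, norm_nonneg z]
  rw [← h] at h1
  simp at h1

theorem coe_discMobius {u a : ℂ} (hu : ‖u‖ = 1) (ha : ‖a‖ < 1) (z : 𝔻) :
    (discMobius u a hu ha z : ℂ) = u * (z - a) / (1 - conj a * z) := rfl

theorem conj_mul_self_of_norm_eq_one {u : ℂ} (hu : ‖u‖ = 1) : conj u * u = 1 := by
  rw [Complex.conj_mul', hu]; simp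

theorem discMobius_surjective {u a : ℂ} (hu : ‖u‖ = 1) (ha : ‖a‖ < 1) :
    Function.Surjective (discMobius u a hu ha) := by
  intro w
  have ha' : ‖-(u * a)‖ < 1 := by simpa [hu] using ha
  -- The inverse automorphism: its zero is the image `-(u a)` of the origin.
  refine ⟨discMobius (conj u) (-(u * a)) (by simpa using hu) ha' w, ?_⟩
  apply UnitDisc.coe_injective
  rw [coe_discMobius, coe_discMobius]
  have h1 := one_sub_conj_mul_ne_zero ha' w.norm_lt_one
  have h2 := one_sub_conj_mul_ne_zero ha ha
  have hu' := conj_mul_self_of_norm_eq_one hu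
  have h3 : 1 - conj a * (conj u * (w - -(u * a)) / (1 - conj (-(u * a)) * w)) =
      (1 - conj a * a) / (1 - conj (-(u * a)) * w) := by
    rw [eq_div_iff h1, sub_mul, mul_assoc, div_mul_cancel₀ _ h1]
    simp only [map_neg, map_mul]
    linear_combination (- conj a * a) * hu'
  rw [h3]
  rw [div_eq_iff (div_ne_zero h2 h1), mul_div_assoc', eq_div_iff h1, mul_assoc, sub_mul,
    div_mul_cancel₀ _ h1]
  simp only [map_neg, map_mul]
  linear_combination (w + u * a - a * conj a * w) * hu'

/-- `K(z, w) = J(z)* K(φ(z), φ(w)) J(w)` for every automorphism `φ` of the disc and some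
cocycle `J` depending on it. -/
def IsMobiusCovariant (K : Matrix 𝔻 𝔻 (V →L[ℂ] V)) : Prop :=
  ∀ (u a : ℂ) (hu : ‖u‖ = 1) (ha : ‖a‖ < 1), ∃ J : 𝔻 → V →L[ℂ] V,
    (∀ w, Function.Surjective (J w)) ∧ ∀ z w x y,
      ⟪x, K z w y⟫_ℂ = ⟪J z x, K (discMobius u a hu ha z) (discMobius u a hu ha w) (J w y)⟫_ℂ

variable {K : Matrix 𝔻 𝔻 (V →L[ℂ] V)} {k : 𝔻 → V →L[ℂ] E}

/-- By covariance, `w ↦ k (φ w) ∘ J w` is a second model of `K` in the same space, so a unitary `U`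
carries the first to it. Then `U* T U` acts on `k w v` by the conjugate of `φ w`, and so does the
Möbius transform of `T`; totality makes them equal. -/
theorem KernelModel.isMobiusInvariant [CompleteSpace E] (h : KernelModel K k)
    (hK : IsMobiusCovariant K) {T : E →L[ℂ] E}
    (hT : ∀ w v, T (k w v) = conj (w : ℂ) • k w v) : IsMobiusInvariant T := by
  intro θ a ha
  set ζ := exp (θ * I) with hζ
  have hζn : ‖ζ‖ = 1 := Complex.norm_exp_ofReal_mul_I θ
  have hζζ := conj_mul_self_of_norm_eq_one hζn
  have hu : ‖conj ζ‖ = 1 := by simpa using hζn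
  have ha' : ‖conj a‖ < 1 := by simpa using ha
  -- Conjugated parameters, because the eigenvalues of `T` are `w̄`: the conjugate of `φ w` must be
  -- the given Möbius map evaluated at `w̄`.
  obtain ⟨J, hJ, hJK⟩ := hK (conj ζ) (conj a) hu ha'
  set φ := discMobius (conj ζ) (conj a) hu ha'
  have hm : KernelModel K fun w => k (φ w) ∘L J w :=
    { inner_apply := fun z w u v => by simp [h.inner_apply, ← hJK]
      total := fun x hx => h.total x fun w v => by
        obtain ⟨w, rfl⟩ := discMobius_surjective hu ha' w
        obtain ⟨v, rfl⟩ := hJ w v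
        exact hx w v }
  obtain ⟨U, hU⟩ := h.exists_linearIsometryEquiv hm
  let T' : E →L[ℂ] E := (U.symm : E →L[ℂ] E) ∘L T ∘L (U : E →L[ℂ] E)
  have hT'U (x : E) : U (T' x) = T (U x) := by simp [T']
  have hT' (w : 𝔻) (v : V) : T' (k w v) = conj (φ w : ℂ) • k w v := by
    apply U.injective
    rw [hT'U, hU, map_smul, hU]
    simp [hT]
  have hφ (w : 𝔻) : conj (φ w : ℂ) * (1 - conj a * conj (w : ℂ)) = ζ * (conj (w : ℂ) - a) := by
    have h1 := one_sub_conj_mul_ne_zero ha (z := conj (w : ℂ)) (by simpa using w.norm_lt_one)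
    rw [coe_discMobius]
    simp only [map_div₀, map_mul, map_sub, map_one, Complex.conj_conj]
    rw [mul_comm (conj a)] at h1 ⊢
    rw [mul_comm (conj (w : ℂ))] at h1 ⊢
    rw [div_mul_cancel₀ _ (by simpa [mul_comm] using h1)]
  have hone : (1 - conj a * a) ≠ 0 := one_sub_conj_mul_ne_zero ha ha
  -- For `y = ζ (x - a) / (1 - ā x)` one has `1 + ā ζ̄ y = (1 - |a|²) / (1 - ā x)`. Hence `T'`
  -- itself supplies the inverse of `1 - ā T`, with no information on the spectrum needed.
  have e1 : (1 - conj a • T) * (1 + (conj a * conj ζ) • T') = (1 - conj a * a) • 1 := by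
    refine h.ext_clm fun w v => ?_
    simp only [mul_apply_eq_comp, add_apply,
      sub_apply, one_apply_eq_self,
      smul_apply, map_add, map_smul, hT, hT']
    match_scalars
    linear_combination (conj a * conj ζ) * hφ w + conj a * (conj (w : ℂ) - a) * hζζ
  have e2 : (1 + (conj a * conj ζ) • T') * (1 - conj a • T) = (1 - conj a * a) • 1 := by
    refine h.ext_clm fun w v => ?_
    simp only [mul_apply_eq_comp, add_apply,
      sub_apply, one_apply_eq_self,
      smul_apply, map_sub, map_smul, hT, hT']
    match_scalars
    linear_combination (conj a * conj ζ) * hφ w + conj a * (conj (w : ℂ) - a) * hζζ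
  have e3 : T' * (1 - conj a • T) = ζ • (T - a • 1) := by
    refine h.ext_clm fun w v => ?_
    simp only [mul_apply_eq_comp,
      sub_apply, one_apply_eq_self,
      smul_apply, map_sub, map_smul, hT, hT']
    match_scalars
    linear_combination hφ w
  have hunit : IsUnit (1 - conj a • T) :=
    ⟨⟨1 - conj a • T, (1 - conj a * a)⁻¹ • (1 + (conj a * conj ζ) • T'),
      by rw [mul_smul_comm, e1, smul_smul, inv_mul_cancel₀ hone, one_smul],
      by rw [smul_mul_assoc, e2, smul_smul, inv_mul_cancel₀ hone, one_smul]⟩, rfl⟩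
  refine ⟨hunit, U, ?_⟩
  have : mobiusOp θ a T = T' := by
    rw [mobiusOp, ← hζ, ← smul_mul_assoc, ← e3, mul_assoc, Ring.mul_inverse_cancel _ hunit,
      mul_one]
  rw [this]
  exact hT'U

theorem KernelModel.cowenDouglas [CompleteSpace E] [TopologicalSpace.SeparableSpace E]
    (h : KernelModel K k) (hK : IsMobiusCovariant K) {T : E →L[ℂ] E}
    (hT : ∀ w v, T (k w v) = conj (w : ℂ) • k w v) (hsurj : Function.Surjective T) {n : ℕ}
    (hn : 0 < n)
    (hker : Module.finrank ℂ (Module.End.eigenspace (T : E →ₗ[ℂ] E) 0) = n) :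
    CowenDouglas n (Metric.ball 0 1) T := by
  have hinv := h.isMobiusInvariant hK hT
  refine ⟨hn, inferInstance, fun w hw => ?_, ?_, fun w hw => ?_⟩
  · rw [(hinv.sub_surjective hsurj (by simpa using hw)).range_eq]
    exact isClosed_univ
  · rw [eq_top_iff, ← h.span_dense]
    refine Submodule.topologicalClosure_mono (Submodule.span_mono ?_)
    rintro _ ⟨w, v, rfl⟩
    exact ⟨conj (w : ℂ), by simpa using w.norm_lt_one, hT w v⟩
  · rw [hinv.finrank_eigenspace (by simpa using hw), hker]

/-- The dimension count makes the range of `k w` the whole eigenspace at `w̄`. The projection onto a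
reducing subspace commutes with `T`, so it preserves these ranges and descends to maps `p w` of `V`;
its self-adjointness is the intertwining relation in `hirr`. A scalar projection has range `0` or
everything. -/
theorem KernelModel.isIrreducibleOp [CompleteSpace E] [FiniteDimensional ℂ V] [Nontrivial V]
    (h : KernelModel K k) (hK : IsMobiusCovariant K) {T : E →L[ℂ] E}
    (hT : ∀ w v, T (k w v) = conj (w : ℂ) • k w v)
    (hker : Module.finrank ℂ (Module.End.eigenspace (T : E →ₗ[ℂ] E) 0) = Module.finrank ℂ V)
    (hinj : ∀ w v, K w w v = 0 → v = 0)
    (hirr : ∀ p : 𝔻 → V →ₗ[ℂ] V,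
      (∀ z w u v, ⟪u, K z w (p w v)⟫_ℂ = ⟪p z u, K z w v⟫_ℂ) → ∃ c : ℂ, ∀ w v, p w v = c • v) :
    IsIrreducibleOp T := by
  have hk (w : 𝔻) : Function.Injective (k w : V →ₗ[ℂ] E) := by
    rw [injective_iff_map_eq_zero]
    intro v hv
    refine hinj w v (ext_inner_left ℂ fun u => ?_)
    rw [← h.inner_apply, show k w v = 0 from hv]
    simp
  have hrange (w : 𝔻) : LinearMap.range (k w : V →ₗ[ℂ] E) =
      Module.End.eigenspace (T : E →ₗ[ℂ] E) (conj (w : ℂ)) := by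
    have hfin := (h.isMobiusInvariant hK hT).finrank_eigenspace (w := conj (w : ℂ))
      (by simpa using w.norm_lt_one)
    rw [hker] at hfin
    -- `finrank` is `0` on infinite dimensional spaces, so a positive value forces finite dimension.
    have : FiniteDimensional ℂ (Module.End.eigenspace (T : E →ₗ[ℂ] E) (conj (w : ℂ))) :=
      Module.finite_of_finrank_pos (by rw [hfin]; exact Module.finrank_pos)
    refine Submodule.eq_of_le_of_finrank_eq ?_ ?_
    · rintro _ ⟨v, rfl⟩
      exact Module.End.mem_eigenspace_iff.2 (hT w v)
    · rw [hfin, LinearMap.finrank_range_of_inj (hk w)]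
  constructor
  · obtain ⟨v, hv⟩ := exists_ne (0 : V)
    exact ⟨⟨k 0 v, 0, fun h0 => hv (hk 0 (by simpa using h0))⟩⟩
  · rintro ⟨N, hNc, hbot, htop, hN, hNo⟩
    have : CompleteSpace N := hNc.completeSpace_coe
    let P := N.starProjection
    have hPT (x : E) : T (P x) = P (T x) := by
      have h1 : T x = T (P x) + T (x - P x) := by rw [← map_add]; simp
      have h2 : P (T (P x)) = T (P x) :=
        Submodule.starProjection_eq_self_iff.2 (hN _ (Submodule.starProjection_apply_mem _ _))
      have h3 : P (T (x - P x)) = 0 :=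
        (Submodule.starProjection_apply_eq_zero_iff _).2
          (hNo _ (Submodule.sub_starProjection_mem_orthogonal _))
      rw [h1, map_add, h2, h3, add_zero]
    have hmem (w : 𝔻) (v : V) : (P : E →ₗ[ℂ] E) ((k w : V →ₗ[ℂ] E) v) ∈
        LinearMap.range (k w : V →ₗ[ℂ] E) := by
      rw [hrange, Module.End.mem_eigenspace_iff]
      show T (P (k w v)) = _ • P (k w v)
      rw [hPT, hT, map_smul]
    let p (w : 𝔻) : V →ₗ[ℂ] V := (LinearEquiv.ofInjective _ (hk w)).symm.toLinearMap ∘ₗ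
      ((P : E →ₗ[ℂ] E) ∘ₗ (k w : V →ₗ[ℂ] E)).codRestrict _ (hmem w)
    have hp (w : 𝔻) (v : V) : k w (p w v) = P (k w v) :=
      congrArg Subtype.val (LinearEquiv.apply_symm_apply (LinearEquiv.ofInjective _ (hk w)) _)
    obtain ⟨c, hc⟩ := hirr p fun z w u v => by
      rw [← h.inner_apply, ← h.inner_apply, hp, hp]
      exact (Submodule.inner_starProjection_left_eq_right N _ _).symm
    have hPc : P = c • (1 : E →L[ℂ] E) := h.ext_clm fun w v => by
      rw [← hp, hc]; simp
    by_cases hc0 : c = 0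
    · apply hbot
      rw [Submodule.eq_bot_iff]
      intro x hx
      rw [← Submodule.starProjection_eq_self_iff.2 hx]
      show P x = 0
      simp [hPc, hc0]
    · apply htop
      rw [Submodule.eq_top_iff']
      intro x
      have : P (c⁻¹ • x) = x := by simp [hPc, hc0]
      rw [← this]
      exact Submodule.starProjection_apply_mem _ _

end DiscKernels

/-! ### The binomial series of `(1 - x) ^ (-t)` and its derivatives -/

section PowerSeries

/-- The coefficients of the power series of `(1 - x) ^ (-t)`. -/
def negBinom (t : ℝ) (n : ℕ) : ℝ := ∏ i ∈ Finset.range n, (t + i) / (i + 1)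

theorem negBinom_succ (t : ℝ) (n : ℕ) :
    negBinom t (n + 1) = negBinom t n * ((t + n) / (n + 1)) := Finset.prod_range_succ _ _

theorem negBinom_pos {t : ℝ} (ht : 0 < t) (n : ℕ) : 0 < negBinom t n :=
  Finset.prod_pos fun i _ => by positivity

/-- Coefficient form of the rule that `(1 - x) ^ (-t)` has derivative `t (1 - x) ^ (-(t + 1))`. It
produces the sums with factors `n + 1` and `(n + 1) ^ 2` below without differentiating series. -/
theorem succ_mul_negBinom_succ (t : ℝ) (n : ℕ) :
    (n + 1) * negBinom t (n + 1) = t * negBinom (t + 1) n := by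
  induction n with
  | zero => simp [negBinom]
  | succ n ih =>
    rw [negBinom_succ t (n + 1), negBinom_succ (t + 1) n]
    push_cast
    have h1 : (n : ℝ) + 1 ≠ 0 := by positivity
    have h2 : (n : ℝ) + 1 + 1 ≠ 0 := by positivity
    field_simp
    linear_combination (t + n + 1) * ih

theorem negBinom_eq_multichoose (t : ℝ) (n : ℕ) :
    (negBinom t n : ℂ) = Ring.multichoose (t : ℂ) n := by
  have h : ∀ n : ℕ, (n.factorial : ℂ) * negBinom t n = (ascPochhammer ℂ n).eval (t : ℂ) := by
    intro n
    induction n with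
    | zero => simp [negBinom]
    | succ n ih =>
      rw [ascPochhammer_succ_eval, ← ih, negBinom_succ, Nat.factorial_succ]
      push_cast
      have h1 : (n : ℂ) + 1 ≠ 0 := by exact_mod_cast n.succ_ne_zero
      field_simp
  have h2 := Ring.factorial_nsmul_multichoose_eq_ascPochhammer (t : ℂ) n
  rw [Polynomial.ascPochhammer_smeval_eq_eval, ← h, nsmul_eq_mul] at h2
  exact (mul_left_cancel₀ (by exact_mod_cast n.factorial_ne_zero) h2).symm

theorem HasSum.of_eq {f g : ℕ → ℂ} {a b : ℂ} (h : HasSum f a) (hfg : ∀ n, g n = f n)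
    (hab : b = a) : HasSum g b := by
  rwa [hab, funext hfg]

theorem hasSum_negBinom (t : ℝ) {x : ℂ} (hx : ‖x‖ < 1) :
    HasSum (fun n => (negBinom t n : ℂ) * x ^ n) ((1 - x) ^ (-(t : ℂ))) := by
  have h := (one_div_one_sub_cpow_hasFPowerSeriesOnBall_zero (t : ℂ)).hasSum (y := x)
    (by simpa [← ofReal_norm] using hx)
  simp only [FormalMultilinearSeries.ofScalars_apply_eq, zero_add, ← Ring.multichoose_eq,
    ← negBinom_eq_multichoose, smul_eq_mul] at h
  rwa [one_div, ← cpow_neg] at h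

theorem one_sub_ne_zero_of_norm_lt_one {x : ℂ} (hx : ‖x‖ < 1) : 1 - x ≠ 0 := by
  intro h
  rw [sub_eq_zero] at h
  simp [← h] at hx

theorem one_sub_cpow_add_one (t : ℝ) {x : ℂ} (hx : ‖x‖ < 1) :
    (1 - x) ^ (-((t + 1 : ℝ) : ℂ)) = (1 - x) ^ (-(t : ℂ)) / (1 - x) := by
  have hx' := one_sub_ne_zero_of_norm_lt_one hx
  rw [ofReal_add, neg_add, cpow_add _ _ hx', ofReal_one, cpow_neg_one, div_eq_mul_inv]

theorem hasSum_succ_mul_negBinom (t : ℝ) {x : ℂ} (hx : ‖x‖ < 1) :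
    HasSum (fun n : ℕ => ((n + 1) * negBinom t (n + 1) : ℂ) * x ^ n)
      ((1 - x) ^ (-(t : ℂ)) * t / (1 - x)) := by
  have h := (hasSum_negBinom (t + 1) hx).mul_left (t : ℂ)
  rw [one_sub_cpow_add_one t hx] at h
  refine h.of_eq (fun n => ?_) ?_
  · have : ((n + 1) * negBinom t (n + 1) : ℂ) = t * negBinom (t + 1) n := by
      exact_mod_cast succ_mul_negBinom_succ t n
    rw [this]; ring
  · ring

theorem hasSum_nat_mul_negBinom (t : ℝ) {x : ℂ} (hx : ‖x‖ < 1) :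
    HasSum (fun n : ℕ => (n * negBinom t n : ℂ) * x ^ n)
      ((1 - x) ^ (-(t : ℂ)) * t * x / (1 - x)) := by
  have h := (hasSum_succ_mul_negBinom t hx).mul_left x
  rw [← hasSum_nat_add_iff' 1]
  refine h.of_eq (fun n => ?_) ?_
  · push_cast
    ring
  · simp
    ring

theorem hasSum_succ_sq_mul_negBinom (t : ℝ) {x : ℂ} (hx : ‖x‖ < 1) :
    HasSum (fun n : ℕ => ((n + 1) ^ 2 * negBinom t (n + 1) : ℂ) * x ^ n)
      ((1 - x) ^ (-(t : ℂ)) * (t * (1 + t * x)) / (1 - x) ^ 2) := by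
  have h := ((hasSum_nat_mul_negBinom (t + 1) hx).add
    (hasSum_negBinom (t + 1) hx)).mul_left (t : ℂ)
  rw [one_sub_cpow_add_one t hx] at h
  have hx' := one_sub_ne_zero_of_norm_lt_one hx
  refine h.of_eq (fun n => ?_) ?_
  · have : ((n + 1) * negBinom t (n + 1) : ℂ) = t * negBinom (t + 1) n := by
      exact_mod_cast succ_mul_negBinom_succ t n
    linear_combination (n + 1) * x ^ n * this
  · push_cast
    field_simp
    ring

theorem hasFPowerSeriesOnBall_of_hasSum {a : ℕ → ℂ} {F : ℂ → ℂ}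
    (h : ∀ z : ℂ, ‖z‖ < 1 → HasSum (fun n => a n * z ^ n) (F z)) :
    HasFPowerSeriesOnBall F (FormalMultilinearSeries.ofScalars ℂ a) 0 1 where
  r_le := by
    refine ENNReal.le_of_forall_nnreal_lt fun r hr => ?_
    apply FormalMultilinearSeries.le_radius_of_summable_norm
    have hr' : ‖((r : ℝ) : ℂ)‖ < 1 := by
      rw [Complex.norm_real, Real.norm_of_nonneg r.coe_nonneg]
      exact_mod_cast hr
    refine (h _ hr').summable.norm.congr fun n => ?_
    simp
  r_pos := one_pos
  hasSum {y} hy := by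
    have hy' : ‖y‖ < 1 := by simpa [← ofReal_norm] using hy
    simpa [FormalMultilinearSeries.ofScalars_apply_eq, mul_comm] using h y hy'

theorem differentiableOn_of_hasSum {a : ℕ → ℂ} {F : ℂ → ℂ}
    (h : ∀ z : ℂ, ‖z‖ < 1 → HasSum (fun n => a n * z ^ n) (F z)) :
    DifferentiableOn ℂ F (Metric.ball 0 1) := by
  have := (hasFPowerSeriesOnBall_of_hasSum h).differentiableOn
  rwa [← ENNReal.ofReal_one, Metric.eball_ofReal] at this

theorem eq_zero_of_hasSum_zero {a : ℕ → ℂ}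
    (h : ∀ z : ℂ, ‖z‖ < 1 → HasSum (fun n => a n * z ^ n) 0) : a = 0 := by
  have h1 := (hasFPowerSeriesOnBall_of_hasSum (F := 0) h).hasFPowerSeriesAt.eq_zero
  rwa [FormalMultilinearSeries.ofScalars_series_eq_zero] at h1

end PowerSeries

/-! ### Weighted shifts and diagonal operators on `ℓ²` -/

section SequenceSpace

/-- The Hilbert space of square summable sequences. -/
abbrev SqSummable := lp (fun _ : ℕ => ℂ) 2

theorem memℓp_two_of_summable {f : ℕ → ℂ} (h : Summable fun n => ‖f n‖ ^ 2) : Memℓp f 2 :=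
  memℓp_gen (by simpa using h)

theorem SqSummable.summable (x : SqSummable) : Summable fun n => ‖x n‖ ^ 2 := by
  simpa using (memℓp_gen_iff (by simp)).1 (lp.memℓp x)

theorem SqSummable.norm_sq (x : SqSummable) : ‖x‖ ^ 2 = ∑' n, ‖x n‖ ^ 2 := by
  simpa using lp.norm_rpow_eq_tsum (p := 2) (by simp) x

instance : TopologicalSpace.SeparableSpace SqSummable := by
  have b : HilbertBasis ℕ ℂ SqSummable := default
  have h := ((Set.countable_range b).isSeparable.span (R := ℂ)).closure
  rw [← Submodule.topologicalClosure_coe, b.dense_span] at h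
  exact TopologicalSpace.isSeparable_univ_iff.1 h

/-- Used twice: `σ n = n + 1` gives backward shifts, and the identity gives diagonal operators. -/
theorem exists_weightedComp {σ : ℕ → ℕ} (hσ : Function.Injective σ) {ω : ℕ → ℝ} {C : ℝ}
    (hω : ∀ n, ω n ^ 2 ≤ C ^ 2) :
    ∃ S : SqSummable →L[ℂ] SqSummable, ∀ x n, S x n = ω n * x (σ n) := by
  have hb (x : SqSummable) (n : ℕ) : ‖ω n * x (σ n)‖ ^ 2 ≤ C ^ 2 * ‖x (σ n)‖ ^ 2 := by
    rw [norm_mul, mul_pow, Complex.norm_real, Real.norm_eq_abs, sq_abs]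
    exact mul_le_mul_of_nonneg_right (hω n) (by positivity)
  have hs (x : SqSummable) : Summable fun n => C ^ 2 * ‖x (σ n)‖ ^ 2 :=
    ((SqSummable.summable x).comp_injective hσ).mul_left _
  have hs' (x : SqSummable) : Summable fun n => ‖ω n * x (σ n)‖ ^ 2 :=
    (hs x).of_nonneg_of_le (fun n => by positivity) (hb x)
  let S₀ : SqSummable →ₗ[ℂ] SqSummable :=
    { toFun := fun x => ⟨fun n => ω n * x (σ n), memℓp_two_of_summable (hs' x)⟩
      map_add' := fun x y => by ext n; exact mul_add _ _ _
      map_smul' := fun c x => by ext n; exact mul_left_comm _ _ _ }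
  refine ⟨S₀.mkContinuous |C| fun x => ?_, fun x n => rfl⟩
  rw [← sq_le_sq₀ (norm_nonneg _) (by positivity), mul_pow, sq_abs, SqSummable.norm_sq x,
    SqSummable.norm_sq, ← tsum_mul_left]
  calc ∑' n, ‖S₀ x n‖ ^ 2 ≤ ∑' n, C ^ 2 * ‖x (σ n)‖ ^ 2 := (hs' x).tsum_le_tsum (hb x) (hs x)
    _ ≤ ∑' n, C ^ 2 * ‖x n‖ ^ 2 :=
      tsum_comp_le_tsum_of_inj ((SqSummable.summable x).mul_left _) (fun n => by positivity) hσ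

theorem surjective_of_backwardShift {S : SqSummable →L[ℂ] SqSummable} {ω : ℕ → ℝ}
    (hS : ∀ x n, S x n = ω n * x (n + 1)) {δ : ℝ} (hδ : 0 < δ) (hω : ∀ n, δ ≤ ω n) :
    Function.Surjective S := by
  intro y
  have hb (n : ℕ) : ‖y n / ω n‖ ^ 2 ≤ (δ ^ 2)⁻¹ * ‖y n‖ ^ 2 := by
    have h0 := hδ.trans_le (hω n)
    rw [norm_div, Complex.norm_real, Real.norm_of_nonneg h0.le, div_pow, div_eq_inv_mul]
    gcongr
    exact hω n
  have hs : Summable fun n => ‖y n / ω n‖ ^ 2 :=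
    ((SqSummable.summable y).mul_left _).of_nonneg_of_le (fun n => by positivity) hb
  -- The coordinate at `0` is lost by the shift, so its value is free; the lower bound on the
  -- weights keeps the preimage in `ℓ²`.
  refine ⟨⟨fun n => Nat.casesOn n 0 fun m => y m / ω m, memℓp_two_of_summable ?_⟩, ?_⟩
  · rw [← summable_nat_add_iff 1]
    exact hs
  · ext n
    have h0 : (ω n : ℂ) ≠ 0 := by exact_mod_cast (hδ.trans_le (hω n)).ne'
    rw [hS]
    exact mul_div_cancel₀ _ h0

theorem finrank_ker_backwardShift {S : SqSummable →L[ℂ] SqSummable} {ω : ℕ → ℝ}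
    (hS : ∀ x n, S x n = ω n * x (n + 1)) (hω : ∀ n, ω n ≠ 0) :
    Module.finrank ℂ (Module.End.eigenspace (S : SqSummable →ₗ[ℂ] SqSummable) 0) = 1 := by
  have : Module.End.eigenspace (S : SqSummable →ₗ[ℂ] SqSummable) 0 =
      Submodule.span ℂ {lp.single 2 0 (1 : ℂ)} := by
    ext x
    rw [Module.End.mem_eigenspace_iff, zero_smul, Submodule.mem_span_singleton]
    constructor
    · intro h
      have hx (n : ℕ) : x (n + 1) = 0 := by
        have h1 := hS x n
        rw [show S x = 0 from h] at h1
        simpa [hω n] using h1.symm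
      refine ⟨x 0, ?_⟩
      ext n
      cases n with
      | zero => simp
      | succ n => simp [hx, lp.single_apply]
    · rintro ⟨c, rfl⟩
      ext n
      show S _ n = 0
      rw [hS]
      simp [lp.single_apply]
  rw [this, finrank_span_singleton]
  intro h
  have := congrArg (fun x : SqSummable => x 0) h
  simp at this

end SequenceSpace

/-! ### Upper triangular operators on a direct sum -/

section Triangular

variable {E E' : Type*} [NormedAddCommGroup E] [InnerProductSpace ℂ E]
  [NormedAddCommGroup E'] [InnerProductSpace ℂ E']

/-- The operator `(x, y) ↦ (A x + C y, D y)` on the Hilbert space direct sum. -/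
def triangularOp (A : E →L[ℂ] E) (C : E' →L[ℂ] E) (D : E' →L[ℂ] E') :
    WithLp 2 (E × E') →L[ℂ] WithLp 2 (E × E') :=
  (WithLp.prodContinuousLinearEquiv 2 ℂ E E').symm.toContinuousLinearMap ∘L
    ((A.coprod C).prod (D ∘L ContinuousLinearMap.snd ℂ E E')) ∘L
    (WithLp.prodContinuousLinearEquiv 2 ℂ E E').toContinuousLinearMap

theorem triangularOp_apply (A : E →L[ℂ] E) (C : E' →L[ℂ] E) (D : E' →L[ℂ] E')
    (x : WithLp 2 (E × E')) :
    triangularOp A C D x = WithLp.toLp 2 (A x.fst + C x.snd, D x.snd) := rfl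

theorem triangularOp_surjective {A : E →L[ℂ] E} (C : E' →L[ℂ] E) {D : E' →L[ℂ] E'}
    (hA : Function.Surjective A) (hD : Function.Surjective D) :
    Function.Surjective (triangularOp A C D) := by
  intro z
  obtain ⟨y, hy⟩ := hD z.snd
  obtain ⟨x, hx⟩ := hA (z.fst - C y)
  refine ⟨WithLp.toLp 2 (x, y), ?_⟩
  rw [triangularOp_apply]
  simp only [WithLp.toLp_fst, WithLp.toLp_snd, hx, hy, sub_add_cancel]
  rfl

/-- If `R` is a right inverse of `A`, the shear `(x, y) ↦ (x + R C y, y)` takes the kernel onto `ker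
A × ker D`. Only linearity of `R` matters for the dimension. -/
theorem finrank_ker_triangularOp {A : E →L[ℂ] E} (C : E' →L[ℂ] E) (D : E' →L[ℂ] E')
    (hA : Function.Surjective A)
    [FiniteDimensional ℂ (Module.End.eigenspace (A : E →ₗ[ℂ] E) 0)]
    [FiniteDimensional ℂ (Module.End.eigenspace (D : E' →ₗ[ℂ] E') 0)] :
    Module.finrank ℂ (Module.End.eigenspace
      (triangularOp A C D : WithLp 2 (E × E') →ₗ[ℂ] WithLp 2 (E × E')) 0) =
      Module.finrank ℂ (Module.End.eigenspace (A : E →ₗ[ℂ] E) 0) +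
      Module.finrank ℂ (Module.End.eigenspace (D : E' →ₗ[ℂ] E') 0) := by
  obtain ⟨R, hR⟩ := (A : E →ₗ[ℂ] E).exists_rightInverse_of_surjective
    (LinearMap.range_eq_top.2 hA)
  have hR' (x : E) : A (R x) = x := DFunLike.congr_fun hR x
  have hmem (x : WithLp 2 (E × E')) : x ∈ Module.End.eigenspace
      (triangularOp A C D : WithLp 2 (E × E') →ₗ[ℂ] WithLp 2 (E × E')) 0 ↔
      x.fst + R (C x.snd) ∈ Module.End.eigenspace (A : E →ₗ[ℂ] E) 0 ∧
        x.snd ∈ Module.End.eigenspace (D : E' →ₗ[ℂ] E') 0 := by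
    simp only [Module.End.mem_eigenspace_iff, zero_smul, ContinuousLinearMap.coe_coe, map_add,
      hR', triangularOp_apply]
    constructor
    · intro h
      exact ⟨congrArg WithLp.fst h, congrArg WithLp.snd h⟩
    · rintro ⟨h1, h2⟩
      exact (WithLp.linearEquiv 2 ℂ (E × E')).injective (Prod.ext h1 h2)
  let e : Module.End.eigenspace
      (triangularOp A C D : WithLp 2 (E × E') →ₗ[ℂ] WithLp 2 (E × E')) 0 ≃ₗ[ℂ]
      Module.End.eigenspace (A : E →ₗ[ℂ] E) 0 × Module.End.eigenspace (D : E' →ₗ[ℂ] E') 0 :=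
    { toFun := fun x =>
        (⟨x.1.fst + R (C x.1.snd), ((hmem _).1 x.2).1⟩, ⟨x.1.snd, ((hmem _).1 x.2).2⟩)
      invFun := fun y => ⟨WithLp.toLp 2 (y.1.1 - R (C y.2.1), y.2.1),
        (hmem _).2 ⟨by simpa using y.1.2, y.2.2⟩⟩
      map_add' := fun x y => by
        ext
        · simp; abel
        · simp
      map_smul' := fun c x => by ext <;> simp
      left_inv := fun x => by
        apply Subtype.ext
        exact (WithLp.linearEquiv 2 ℂ (E × E')).injective
          (Prod.ext (add_sub_cancel_right _ _) rfl)
      right_inv := fun x => by ext <;> simp }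
  rw [e.finrank_eq, Module.finrank_prod]

end Triangular

/-! ### Sequence models of the scalar and the bidisc jet kernels -/

section SequenceModels

theorem norm_mul_conj_lt_one (z w : 𝔻) : ‖(z : ℂ) * conj (w : ℂ)‖ < 1 := by
  rw [norm_mul, RCLike.norm_conj]
  nlinarith [z.norm_lt_one, w.norm_lt_one, norm_nonneg (z : ℂ), norm_nonneg (w : ℂ)]

theorem one_sub_mul_conj_ne_zero (z w : 𝔻) : 1 - (z : ℂ) * conj (w : ℂ) ≠ 0 :=
  one_sub_ne_zero_of_norm_lt_one (norm_mul_conj_lt_one z w)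

/-- The vectors representing point evaluations, in an orthonormal basis of monomials of the space
with kernel `(1 - z w̄) ^ (-t)`. -/
def discVec (t : ℝ) (ht : 0 < t) (w : 𝔻) : SqSummable :=
  ⟨fun n => (√(negBinom t n) : ℂ) * conj (w : ℂ) ^ n, memℓp_two_of_summable (by
    refine (hasSum_negBinom t (norm_mul_conj_lt_one w w)).summable.norm.congr fun n => ?_
    simp only [norm_mul, norm_pow, Complex.norm_real, RCLike.norm_conj, Real.norm_eq_abs,
      mul_pow, sq_abs, Real.sq_sqrt (negBinom_pos ht n).le, abs_of_pos (negBinom_pos ht n)]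
    ring)⟩

/-- The vectors representing evaluations of derivatives, in the same basis. -/
def discVecDeriv (t : ℝ) (ht : 0 < t) (w : 𝔻) : SqSummable :=
  ⟨fun n => (√(negBinom t n) : ℂ) * (n * conj (w : ℂ) ^ (n - 1)), memℓp_two_of_summable (by
    rw [← summable_nat_add_iff 1]
    refine (hasSum_succ_sq_mul_negBinom t (norm_mul_conj_lt_one w w)).summable.norm.congr
      fun n => ?_
    simp only [norm_mul, norm_pow, Complex.norm_real, RCLike.norm_conj, Real.norm_eq_abs,
      mul_pow, sq_abs, Real.sq_sqrt (negBinom_pos ht _).le, abs_of_pos (negBinom_pos ht _),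
      Nat.add_sub_cancel, Nat.cast_add, Nat.cast_one]
    ring)⟩

variable {t : ℝ} (ht : 0 < t)

theorem discVec_apply (w : 𝔻) (n : ℕ) :
    discVec t ht w n = (√(negBinom t n) : ℂ) * conj (w : ℂ) ^ n := rfl

theorem discVecDeriv_apply (w : 𝔻) (n : ℕ) :
    discVecDeriv t ht w n = (√(negBinom t n) : ℂ) * (n * conj (w : ℂ) ^ (n - 1)) := rfl

include ht in
theorem sqrt_negBinom_mul_self (n : ℕ) :
    (√(negBinom t n) : ℂ) * (√(negBinom t n) : ℂ) = negBinom t n := by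
  exact_mod_cast Real.mul_self_sqrt (negBinom_pos ht n).le

include ht in
theorem sqrt_negBinom_ne_zero (n : ℕ) : (√(negBinom t n) : ℂ) ≠ 0 := by
  exact_mod_cast (Real.sqrt_pos.2 (negBinom_pos ht n)).ne'

theorem inner_discVec_discVec (z w : 𝔻) : ⟪discVec t ht z, discVec t ht w⟫_ℂ =
    (1 - (z : ℂ) * conj (w : ℂ)) ^ (-(t : ℂ)) := by
  refine (lp.hasSum_inner _ _).unique
    ((hasSum_negBinom t (norm_mul_conj_lt_one z w)).of_eq (fun n => ?_) rfl)
  rw [RCLike.inner_apply, discVec_apply, discVec_apply, ← sqrt_negBinom_mul_self ht]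
  simp only [map_mul, map_pow, Complex.conj_ofReal, Complex.conj_conj]
  ring

theorem inner_discVec_discVecDeriv (z w : 𝔻) : ⟪discVec t ht z, discVecDeriv t ht w⟫_ℂ =
    (1 - (z : ℂ) * conj (w : ℂ)) ^ (-(t : ℂ)) * t * z / (1 - (z : ℂ) * conj (w : ℂ)) := by
  refine (lp.hasSum_inner _ _).unique ?_
  -- The term at `0` carries the factor `n = 0`, so it may be dropped; this also makes the truncated
  -- exponent `n - 1` harmless.
  rw [← hasSum_nat_add_iff' 1]
  refine ((hasSum_succ_mul_negBinom t (norm_mul_conj_lt_one z w)).mul_left (z : ℂ)).of_eq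
    (fun n => ?_) ?_
  · rw [RCLike.inner_apply, discVec_apply, discVecDeriv_apply, ← sqrt_negBinom_mul_self ht]
    simp only [map_mul, map_pow, Complex.conj_ofReal, Complex.conj_conj, Nat.add_sub_cancel,
      Nat.cast_add, Nat.cast_one]
    ring
  · simp [discVecDeriv_apply]
    ring

theorem inner_discVecDeriv_discVec (z w : 𝔻) : ⟪discVecDeriv t ht z, discVec t ht w⟫_ℂ =
    (1 - (z : ℂ) * conj (w : ℂ)) ^ (-(t : ℂ)) * t * conj (w : ℂ) /
      (1 - (z : ℂ) * conj (w : ℂ)) := by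
  refine (lp.hasSum_inner _ _).unique ?_
  rw [← hasSum_nat_add_iff' 1]
  refine ((hasSum_succ_mul_negBinom t (norm_mul_conj_lt_one z w)).mul_left
    (conj (w : ℂ))).of_eq (fun n => ?_) ?_
  · rw [RCLike.inner_apply, discVec_apply, discVecDeriv_apply, ← sqrt_negBinom_mul_self ht]
    simp only [map_mul, map_pow, Complex.conj_ofReal, Complex.conj_conj, Nat.add_sub_cancel,
      Nat.cast_add, Nat.cast_one, map_add, map_one, map_natCast]
    ring
  · simp [discVecDeriv_apply]
    ring

theorem inner_discVecDeriv_discVecDeriv (z w : 𝔻) :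
    ⟪discVecDeriv t ht z, discVecDeriv t ht w⟫_ℂ =
    (1 - (z : ℂ) * conj (w : ℂ)) ^ (-(t : ℂ)) * (t * (1 + t * (z * conj (w : ℂ)))) /
      (1 - (z : ℂ) * conj (w : ℂ)) ^ 2 := by
  refine (lp.hasSum_inner _ _).unique ?_
  rw [← hasSum_nat_add_iff' 1]
  refine (hasSum_succ_sq_mul_negBinom t (norm_mul_conj_lt_one z w)).of_eq (fun n => ?_) ?_
  · rw [RCLike.inner_apply, discVecDeriv_apply, discVecDeriv_apply, ← sqrt_negBinom_mul_self ht]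
    simp only [map_mul, map_pow, Complex.conj_ofReal, Complex.conj_conj, Nat.add_sub_cancel,
      Nat.cast_add, Nat.cast_one, map_add, map_one, map_natCast]
    ring
  · simp [discVecDeriv_apply]

theorem hasSum_inner_discVec (x : SqSummable) (z : 𝔻) :
    HasSum (fun n => ((√(negBinom t n) : ℂ) * x n) * (z : ℂ) ^ n) ⟪discVec t ht z, x⟫_ℂ := by
  refine (lp.hasSum_inner (𝕜 := ℂ) (discVec t ht z) x).of_eq (fun n => ?_) rfl
  rw [RCLike.inner_apply, discVec_apply]
  simp only [map_mul, map_pow, Complex.conj_ofReal, Complex.conj_conj]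
  ring

theorem hasSum_inner_discVecDeriv (x : SqSummable) (z : 𝔻) :
    HasSum (fun n : ℕ => ((√(negBinom t (n + 1)) : ℂ) * (n + 1) * x (n + 1)) * (z : ℂ) ^ n)
      ⟪discVecDeriv t ht z, x⟫_ℂ := by
  have h := lp.hasSum_inner (𝕜 := ℂ) (discVecDeriv t ht z) x
  rw [← hasSum_nat_add_iff' 1] at h
  refine h.of_eq (fun n => ?_) ?_
  · rw [RCLike.inner_apply, discVecDeriv_apply]
    simp only [map_mul, map_pow, Complex.conj_ofReal, Complex.conj_conj, Nat.add_sub_cancel,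
      Nat.cast_add, Nat.cast_one, map_add, map_one, map_natCast]
    ring
  · simp [discVecDeriv_apply]

theorem exists_holomorphic_of_hasSum {a : ℕ → ℂ} {G : 𝔻 → ℂ}
    (h : ∀ z : 𝔻, HasSum (fun n => a n * (z : ℂ) ^ n) (G z)) :
    ∃ F : ℂ → ℂ, DifferentiableOn ℂ F (Metric.ball 0 1) ∧ ∀ z : 𝔻, F z = G z := by
  have h1 (z : ℂ) (hz : ‖z‖ < 1) :
      HasSum (fun n => a n * z ^ n) (∑' n, a n * z ^ n) := by
    have h1 := (h (UnitDisc.mk z hz)).summable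
    rw [UnitDisc.coe_mk] at h1
    exact h1.hasSum
  exact ⟨_, differentiableOn_of_hasSum h1, fun z => (h z).tsum_eq⟩

theorem eq_zero_of_inner_discVec {x : SqSummable} (h : ∀ z, ⟪discVec t ht z, x⟫_ℂ = 0) :
    x = 0 := by
  have h1 : (fun n => (√(negBinom t n) : ℂ) * x n) = 0 := eq_zero_of_hasSum_zero fun z hz => by
    have h2 := hasSum_inner_discVec ht x (UnitDisc.mk z hz)
    rwa [h, UnitDisc.coe_mk] at h2
  ext n
  have := congrFun h1 n
  simpa [sqrt_negBinom_ne_zero ht n] using this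

include ht in
-- The shift must send `√c (n + 1)` to `√c n` for `c = negBinom t`, which fixes weights with square
-- `(n + 1) / (t + n)`, bounded above and away from zero. The extra term `discVec` in the action on
-- `discVecDeriv` is the derivative of the eigenvalue `w̄`.
theorem exists_backwardShift : ∃ A : SqSummable →L[ℂ] SqSummable,
    (∀ w, A (discVec t ht w) = conj (w : ℂ) • discVec t ht w) ∧
    (∀ w, A (discVecDeriv t ht w) = discVec t ht w + conj (w : ℂ) • discVecDeriv t ht w) ∧
    Function.Surjective A ∧
    Module.finrank ℂ (Module.End.eigenspace (A : SqSummable →ₗ[ℂ] SqSummable) 0) = 1 := by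
  have hsq (n : ℕ) : (√(negBinom t n) / √(negBinom t (n + 1))) ^ 2 = (n + 1) / (t + n) := by
    rw [div_pow, Real.sq_sqrt (negBinom_pos ht _).le, Real.sq_sqrt (negBinom_pos ht _).le,
      negBinom_succ]
    have := (negBinom_pos ht n).ne'
    field_simp
  have hpos (n : ℕ) : 0 < √(negBinom t n) / √(negBinom t (n + 1)) :=
    div_pos (Real.sqrt_pos.2 (negBinom_pos ht _)) (Real.sqrt_pos.2 (negBinom_pos ht _))
  obtain ⟨A, hA⟩ := exists_weightedComp (add_left_injective 1)
    (ω := fun n => √(negBinom t n) / √(negBinom t (n + 1))) (C := 1 + 1 / t) (fun n => by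
      rw [hsq, div_le_iff₀ (by positivity)]
      have : 1 ≤ 1 + 1 / t := by simp [ht.le]
      have h2 : (1 + 1 / t) * (t + n) = n + 1 + t + n / t := by field_simp; ring
      have h3 : 0 ≤ n / t := by positivity
      nlinarith)
  refine ⟨A, fun w => ?_, fun w => ?_, ?_, ?_⟩
  · ext n
    have h1 := sqrt_negBinom_ne_zero ht (n + 1)
    rw [hA, discVec_apply]
    simp only [lp.coeFn_smul, Pi.smul_apply, smul_eq_mul, discVec_apply]
    push_cast
    field_simp
    ring
  · ext n
    have h1 := sqrt_negBinom_ne_zero ht (n + 1)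
    rw [hA, discVecDeriv_apply]
    simp only [lp.coeFn_smul, lp.coeFn_add, Pi.add_apply, Pi.smul_apply, smul_eq_mul,
      discVec_apply, discVecDeriv_apply]
    push_cast
    cases n with
    | zero => simp at h1 ⊢; field_simp
    | succ n => simp only [Nat.add_sub_cancel]; field_simp; push_cast; ring
  · refine surjective_of_backwardShift hA (δ := 1 / (1 + t)) (by positivity) fun n => ?_
    rw [← sq_le_sq₀ (by positivity) (hpos n).le, hsq, div_pow, div_le_div_iff₀ (by positivity)
      (by positivity)]
    have : (0 : ℝ) ≤ n := n.cast_nonneg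
    nlinarith [mul_nonneg this ht.le, mul_nonneg this (sq_nonneg t), sq_nonneg t]
  · exact finrank_ker_backwardShift hA fun n => (hpos n).ne'

include ht in
-- A diagonal operator suffices; it is bounded since the binomial coefficients increase with `t`.
theorem exists_intertwiner (c : ℝ) : ∃ C : SqSummable →L[ℂ] SqSummable,
    ∀ w, C (discVec (t + 2) (by positivity) w) = (c : ℂ) • discVec t ht w := by
  have ht2 : 0 < t + 2 := by positivity
  have hle (n : ℕ) : negBinom t n ≤ negBinom (t + 2) n :=
    Finset.prod_le_prod (fun i _ => by positivity) fun i _ => by gcongr; linarith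
  obtain ⟨C, hC⟩ := exists_weightedComp (Function.injective_id)
    (ω := fun n => c * (√(negBinom t n) / √(negBinom (t + 2) n))) (C := c) (fun n => by
      rw [mul_pow, div_pow, Real.sq_sqrt (negBinom_pos ht _).le,
        Real.sq_sqrt (negBinom_pos ht2 _).le]
      exact mul_le_of_le_one_right (sq_nonneg c)
        ((div_le_one (negBinom_pos ht2 n)).2 (hle n)))
  refine ⟨C, fun w => ?_⟩
  ext n
  have h1 := sqrt_negBinom_ne_zero ht2 n
  rw [hC]
  simp only [lp.coeFn_smul, Pi.smul_apply, smul_eq_mul, discVec_apply, id]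
  push_cast
  field_simp

theorem kernelModel_discKernel : KernelModel (discKernel t)
    fun w => ContinuousLinearMap.toSpanSingleton ℂ (discVec t ht w) where
  inner_apply z w u v := by
    simp only [ContinuousLinearMap.toSpanSingleton_apply, inner_smul_left, inner_smul_right,
      inner_discVec_discVec, discKernel, Matrix.of_apply, RCLike.inner_apply]
    simp
    ring
  total x hx := eq_zero_of_inner_discVec ht fun z => by simpa using hx z 1

/-- The coordinate functionals. -/
abbrev coordCLM {n : ℕ} (i : Fin n) : EuclideanSpace ℂ (Fin n) →L[ℂ] ℂ := EuclideanSpace.proj i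

/-- The vectors `k(w) v` in the sequence model of the jet kernel of `(1 - z₁w̄₁)^{-a}(1 - z₂w̄₂)^{-b}`. -/
def bidiscVec (a b : ℝ) (ha : 0 < a) (hb : 0 < b) (w : 𝔻) :
    EuclideanSpace ℂ (Fin 2) →L[ℂ] WithLp 2 (SqSummable × SqSummable) :=
  (WithLp.prodContinuousLinearEquiv 2 ℂ SqSummable SqSummable).symm.toContinuousLinearMap ∘L
    ((coordCLM 0).smulRight (discVec (a + b) (add_pos ha hb) w) +
      (coordCLM 1).smulRight
        (((b / (a + b) : ℝ) : ℂ) • discVecDeriv (a + b) (add_pos ha hb) w)).prod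
    ((coordCLM 1).smulRight
      (((√(a * b / (a + b)) : ℝ) : ℂ) • discVec (a + b + 2) (by positivity) w))

variable {a b : ℝ} (ha : 0 < a) (hb : 0 < b)

theorem bidiscVec_apply (w : 𝔻) (v : EuclideanSpace ℂ (Fin 2)) :
    bidiscVec a b ha hb w v = WithLp.toLp 2
      (v 0 • discVec (a + b) (add_pos ha hb) w +
        v 1 • ((b / (a + b) : ℝ) : ℂ) • discVecDeriv (a + b) (add_pos ha hb) w,
      v 1 • ((√(a * b / (a + b)) : ℝ) : ℂ) • discVec (a + b + 2) (by positivity) w) := rfl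

/-- This explains the constants in `bidiscVec`. The off-diagonal entries of the jet kernel are those
of the derivative vectors for exponent `a + b`, scaled by `b / (a + b)`. What then remains of the
last entry is `b - b² / (a + b) = ab / (a + b)` over `(1 - z w̄)²`, a multiple of the kernel with
exponent `a + b + 2`. -/
theorem inner_bidiscVec (z w : 𝔻) (u v : EuclideanSpace ℂ (Fin 2)) :
    ⟪bidiscVec a b ha hb z u, bidiscVec a b ha hb w v⟫_ℂ =
      (1 - (z : ℂ) * conj (w : ℂ)) ^ (-((a + b : ℝ) : ℂ)) *
      (conj (u 0) * v 0 + conj (u 0) * v 1 * (b * z / (1 - (z : ℂ) * conj (w : ℂ))) +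
        conj (u 1) * v 0 * (b * conj (w : ℂ) / (1 - (z : ℂ) * conj (w : ℂ))) +
        conj (u 1) * v 1 * (b * (1 + b * (z * conj (w : ℂ))) /
          (1 - (z : ℂ) * conj (w : ℂ)) ^ 2)) := by
  have hab : 0 < a + b := add_pos ha hb
  have hs := one_sub_mul_conj_ne_zero z w
  have hμ : ((√(a * b / (a + b)) : ℝ) : ℂ) * ((√(a * b / (a + b)) : ℝ) : ℂ) =
      ((a * b / (a + b) : ℝ) : ℂ) := by
    exact_mod_cast Real.mul_self_sqrt (by positivity)
  rw [bidiscVec_apply, bidiscVec_apply, WithLp.prod_inner_apply]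
  simp only [inner_add_left, inner_add_right, inner_smul_left, inner_smul_right,
    inner_discVec_discVec, inner_discVec_discVecDeriv, inner_discVecDeriv_discVec,
    inner_discVecDeriv_discVecDeriv, Complex.conj_ofReal]
  have h2 : (1 - (z : ℂ) * conj (w : ℂ)) ^ (-((a + b + 2 : ℝ) : ℂ)) =
      (1 - (z : ℂ) * conj (w : ℂ)) ^ (-((a + b : ℝ) : ℂ)) / (1 - (z : ℂ) * conj (w : ℂ)) ^ 2 := by
    rw [show a + b + 2 = a + b + 1 + 1 by ring, one_sub_cpow_add_one _ (norm_mul_conj_lt_one z w),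
      one_sub_cpow_add_one _ (norm_mul_conj_lt_one z w), div_div, sq]
  rw [h2]
  generalize (1 - (z : ℂ) * conj (w : ℂ)) ^ (-((a + b : ℝ) : ℂ)) = q
  have hab' : (a : ℂ) + b ≠ 0 := by exact_mod_cast hab.ne'
  generalize ((√(a * b / (a + b)) : ℝ) : ℂ) = μ at hμ ⊢
  generalize conj (w : ℂ) = w' at hs ⊢
  have hμ' : μ ^ 2 = a * b / (a + b) := by rw [sq, hμ]; push_cast; rfl
  generalize hs' : (1 - (z : ℂ) * w') = s at hs ⊢
  push_cast at hμ' ⊢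
  field_simp at hμ' ⊢
  linear_combination (conj (u 1) * v 1 * q) * hμ'

theorem total_bidiscVec {x : WithLp 2 (SqSummable × SqSummable)}
    (hx : ∀ w v, ⟪bidiscVec a b ha hb w v, x⟫_ℂ = 0) : x = 0 := by
  simp only [bidiscVec_apply, WithLp.prod_inner_apply] at hx
  have h1 : x.fst = 0 := eq_zero_of_inner_discVec (add_pos ha hb) fun z => by
    simpa using hx z (EuclideanSpace.single 0 1)
  have h2 : x.snd = 0 := eq_zero_of_inner_discVec (t := a + b + 2) (by positivity) fun z => by
    have h := hx z (EuclideanSpace.single 1 1)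
    have hμ : ((√(a * b / (a + b)) : ℝ) : ℂ) ≠ 0 := by
      exact_mod_cast (Real.sqrt_pos.2 (by positivity)).ne'
    have h1' : x.ofLp.1 = 0 := h1
    rw [h1'] at h
    simp only [inner_zero_right, zero_add, inner_smul_left] at h
    simpa [hμ] using h
  exact (WithLp.linearEquiv 2 ℂ (SqSummable × SqSummable)).injective (Prod.ext h1 h2)

include ha hb in
-- On the first component the shift produces an unwanted multiple of `discVec`, from its action on
-- the derivative vector. The off-diagonal operator `C`, fed by the second component, cancels it.
theorem exists_bidiscBackward :
    ∃ T : WithLp 2 (SqSummable × SqSummable) →L[ℂ] WithLp 2 (SqSummable × SqSummable),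
      (∀ w v, T (bidiscVec a b ha hb w v) = conj (w : ℂ) • bidiscVec a b ha hb w v) ∧
      Function.Surjective T ∧
      Module.finrank ℂ (Module.End.eigenspace
        (T : WithLp 2 (SqSummable × SqSummable) →ₗ[ℂ] WithLp 2 (SqSummable × SqSummable)) 0)
          = 2 := by
  have hab : 0 < a + b := add_pos ha hb
  obtain ⟨A, hA, hA', hAs, hAk⟩ := exists_backwardShift hab
  obtain ⟨D, hD, -, hDs, hDk⟩ := exists_backwardShift (t := a + b + 2) (by positivity)
  -- Minus the coefficient of the derivative vector, divided by the coefficient of the second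
  -- component.
  obtain ⟨C, hC⟩ := exists_intertwiner hab (-(b / (a + b)) / √(a * b / (a + b)))
  have hμ : ((√(a * b / (a + b)) : ℝ) : ℂ) ≠ 0 := by
    exact_mod_cast (Real.sqrt_pos.2 (by positivity)).ne'
  have fA : FiniteDimensional ℂ (Module.End.eigenspace (A : SqSummable →ₗ[ℂ] SqSummable) 0) :=
    Module.finite_of_finrank_pos (by rw [hAk]; exact one_pos)
  have fD : FiniteDimensional ℂ (Module.End.eigenspace (D : SqSummable →ₗ[ℂ] SqSummable) 0) :=
    Module.finite_of_finrank_pos (by rw [hDk]; exact one_pos)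
  refine ⟨triangularOp A C D, fun w v => ?_, triangularOp_surjective C hAs hDs, ?_⟩
  · rw [bidiscVec_apply, triangularOp_apply]
    refine (WithLp.linearEquiv 2 ℂ (SqSummable × SqSummable)).injective (Prod.ext ?_ ?_)
    · show A (v 0 • discVec _ _ _ + v 1 • _ • discVecDeriv _ _ _) + C (v 1 • _ • discVec _ _ _) =
        _ • (v 0 • discVec _ _ _ + v 1 • _ • discVecDeriv _ _ _)
      simp only [map_add, map_smul, hA, hA', hC]
      match_scalars
      · field_simp
        ring
      · ring
    · show D (v 1 • _ • discVec _ _ _) = _ • v 1 • _ • discVec _ _ _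
      rw [map_smul, map_smul, hD]
      match_scalars
      ring
  · rw [finrank_ker_triangularOp C D hAs, hAk, hDk]

theorem exists_holomorphic_inner_discVec (x : SqSummable) (v : ℂ) :
    ∃ F : ℂ → ℂ, DifferentiableOn ℂ F (Metric.ball 0 1) ∧ ∀ z : 𝔻,
      F z = ⟪ContinuousLinearMap.toSpanSingleton ℂ (discVec t ht z) v, x⟫_ℂ := by
  obtain ⟨F, hF, hF'⟩ := exists_holomorphic_of_hasSum (hasSum_inner_discVec ht x)
  exact ⟨fun z => conj v * F z, hF.const_mul _, fun z => by
    beta_reduce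
    rw [hF', ContinuousLinearMap.toSpanSingleton_apply, inner_smul_left]⟩

theorem exists_holomorphic_inner_bidiscVec (x : WithLp 2 (SqSummable × SqSummable))
    (v : EuclideanSpace ℂ (Fin 2)) :
    ∃ F : ℂ → ℂ, DifferentiableOn ℂ F (Metric.ball 0 1) ∧ ∀ z : 𝔻,
      F z = ⟪bidiscVec a b ha hb z v, x⟫_ℂ := by
  obtain ⟨F, hF, hF'⟩ := exists_holomorphic_of_hasSum
    (hasSum_inner_discVec (add_pos ha hb) x.fst)
  obtain ⟨F₁, hF₁, hF₁'⟩ := exists_holomorphic_of_hasSum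
    (hasSum_inner_discVecDeriv (add_pos ha hb) x.fst)
  obtain ⟨F₂, hF₂, hF₂'⟩ := exists_holomorphic_of_hasSum
    (hasSum_inner_discVec (t := a + b + 2) (by positivity) x.snd)
  refine ⟨fun z => conj (v 0) * F z + conj (v 1) * ((b / (a + b) : ℝ) * F₁ z) +
    conj (v 1) * ((√(a * b / (a + b)) : ℝ) * F₂ z),
    ((hF.const_mul _).add ((hF₁.const_mul _).const_mul _)).add
      ((hF₂.const_mul _).const_mul _), fun z => ?_⟩
  beta_reduce
  rw [hF', hF₁', hF₂', bidiscVec_apply, WithLp.prod_inner_apply]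
  simp only [inner_add_left, inner_smul_left, Complex.conj_ofReal]
  rfl

end SequenceModels

/-! ### Explicit entries of the jet kernels -/

section JetKernels

theorem wirtinger_eq_of_hasDerivAt {f : ℂ → ℂ} {f' z : ℂ} (h : HasDerivAt f f' z) :
    wirtinger f z = f' := by
  rw [wirtinger, (h.hasFDerivAt.restrictScalars ℝ).fderiv]
  simp
  linear_combination (-(1 / 2) * f') * Complex.I_mul_I

theorem wirtingerBar_eq_of_hasDerivAt {f g : ℂ → ℂ} {g' z : ℂ} (hf : ∀ t, f t = g (conj t))
    (h : HasDerivAt g g' (conj z)) : wirtingerBar f z = g' := by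
  have h2 := (h.hasFDerivAt.restrictScalars ℝ).comp z
      (Complex.conjCLE : ℂ ≃L[ℝ] ℂ).hasFDerivAt
  rw [wirtingerBar, show f = g ∘ conj from funext hf, h2.fderiv]
  simp
  linear_combination (-(1 / 2) * g') * Complex.I_mul_I

theorem wirtinger_congr {f g : ℂ → ℂ} {z : ℂ} (h : f =ᶠ[nhds z] g) :
    wirtinger f z = wirtinger g z := by
  rw [wirtinger, wirtinger, h.fderiv_eq]

theorem wirtingerBar_congr {f g : ℂ → ℂ} {z : ℂ} (h : f =ᶠ[nhds z] g) :
    wirtingerBar f z = wirtingerBar g z := by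
  rw [wirtingerBar, wirtingerBar, h.fderiv_eq]

theorem norm_mul_lt_one_of_norm_lt_one {z w : ℂ} (hz : ‖z‖ < 1) (hw : ‖w‖ < 1) :
    ‖z * w‖ < 1 := by
  rw [norm_mul]
  nlinarith [norm_nonneg z, norm_nonneg w]

theorem one_sub_mul_conj_ne_zero_of_norm_lt_one {z w : ℂ} (hz : ‖z‖ < 1) (hw : ‖w‖ < 1) :
    1 - z * conj w ≠ 0 :=
  one_sub_ne_zero_of_norm_lt_one (norm_mul_lt_one_of_norm_lt_one hz (by simpa using hw))

theorem hasDerivAt_one_sub_mul_cpow (c : ℝ) {z w : ℂ} (hz : ‖z‖ < 1) (hw : ‖w‖ < 1) :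
    HasDerivAt (fun t => (1 - t * w) ^ (-(c : ℂ)))
      (c * w / (1 - z * w) * (1 - z * w) ^ (-(c : ℂ))) z := by
  have hn := norm_mul_lt_one_of_norm_lt_one hz hw
  have h1 : HasDerivAt (fun t => 1 - t * w) (-w) z := by
    simpa using ((hasDerivAt_id z).mul_const w).const_sub 1
  have hs : 1 - z * w ∈ slitPlane := by
    rw [sub_eq_add_neg]
    exact mem_slitPlane_of_norm_lt_one (by simpa using hn)
  convert h1.cpow_const (c := -(c : ℂ)) hs using 1
  rw [cpow_sub _ _ (one_sub_ne_zero_of_norm_lt_one hn), cpow_one]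
  ring

variable {m : ℕ} (a : Fin m → ℝ) {z w : Fin m → ℂ}

theorem hasDerivAt_polydiscKernel_left (i : Fin m) (hz : ‖z i‖ < 1) (hw : ‖w i‖ < 1) :
    HasDerivAt (fun t => polydiscKernel a (Function.update z i t) w)
      (a i * conj (w i) / (1 - z i * conj (w i)) * polydiscKernel a z w) (z i) := by
  have h1 (t : ℂ) : polydiscKernel a (Function.update z i t) w =
      (1 - t * conj (w i)) ^ (-(a i : ℂ)) *
        ∏ j ∈ Finset.univ.erase i, (1 - z j * conj (w j)) ^ (-(a j : ℂ)) := by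
    rw [polydiscKernel, ← Finset.mul_prod_erase _ _ (Finset.mem_univ i), Function.update_self]
    congr 1
    refine Finset.prod_congr rfl fun j hj => ?_
    rw [Function.update_of_ne (Finset.ne_of_mem_erase hj)]
  have h2 := (hasDerivAt_one_sub_mul_cpow (a i) hz (w := conj (w i))
    (by simpa using hw)).mul_const
      (∏ j ∈ Finset.univ.erase i, (1 - z j * conj (w j)) ^ (-(a j : ℂ)))
  rw [mul_assoc, ← h1, Function.update_eq_self] at h2
  simpa only [← h1] using h2

theorem hasDerivAt_polydiscKernel_right (i : Fin m) (hz : ‖z i‖ < 1) (hw : ‖w i‖ < 1) :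
    HasDerivAt (fun t => polydiscKernel a z (Function.update w i (conj t)))
      (a i * z i / (1 - z i * conj (w i)) * polydiscKernel a z w) (conj (w i)) := by
  have h1 (t : ℂ) : polydiscKernel a z (Function.update w i (conj t)) =
      (1 - t * z i) ^ (-(a i : ℂ)) *
        ∏ j ∈ Finset.univ.erase i, (1 - z j * conj (w j)) ^ (-(a j : ℂ)) := by
    rw [polydiscKernel, ← Finset.mul_prod_erase _ _ (Finset.mem_univ i), Function.update_self,
      Complex.conj_conj, mul_comm t]
    congr 1
    refine Finset.prod_congr rfl fun j hj => ?_
    rw [Function.update_of_ne (Finset.ne_of_mem_erase hj)]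
  have h2 := (hasDerivAt_one_sub_mul_cpow (a i) (z := conj (w i)) (by simpa using hw) hz).mul_const
      (∏ j ∈ Finset.univ.erase i, (1 - z j * conj (w j)) ^ (-(a j : ℂ)))
  rw [mul_assoc, ← h1, Complex.conj_conj, Function.update_eq_self, mul_comm (conj (w i))] at h2
  simpa only [← h1] using h2

theorem kernelD_polydiscKernel (i : Fin m) (hz : ‖z i‖ < 1) (hw : ‖w i‖ < 1) :
    kernelD i (polydiscKernel a) z w =
      a i * conj (w i) / (1 - z i * conj (w i)) * polydiscKernel a z w :=
  wirtinger_eq_of_hasDerivAt (hasDerivAt_polydiscKernel_left a i hz hw)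

theorem kernelDBar_polydiscKernel (i : Fin m) (hz : ‖z i‖ < 1) (hw : ‖w i‖ < 1) :
    kernelDBar i (polydiscKernel a) z w =
      a i * z i / (1 - z i * conj (w i)) * polydiscKernel a z w :=
  wirtingerBar_eq_of_hasDerivAt (fun t => by rw [Complex.conj_conj])
    (hasDerivAt_polydiscKernel_right a i hz hw)

theorem eventually_norm_lt_one {z : ℂ} (hz : ‖z‖ < 1) : ∀ᶠ t in nhds z, ‖t‖ < 1 :=
  continuous_norm.continuousAt.eventually (gt_mem_nhds hz)

theorem kernelD_kernelDBar_of_ne {i j : Fin m} (hij : i ≠ j) (hz : ∀ i, ‖z i‖ < 1)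
    (hw : ∀ i, ‖w i‖ < 1) :
    kernelD i (kernelDBar j (polydiscKernel a)) z w =
      (a i * conj (w i) / (1 - z i * conj (w i))) * (a j * z j / (1 - z j * conj (w j))) *
        polydiscKernel a z w := by
  have h : (fun t => kernelDBar j (polydiscKernel a) (Function.update z i t) w) = fun t =>
      a j * z j / (1 - z j * conj (w j)) * polydiscKernel a (Function.update z i t) w := by
    ext t
    rw [kernelDBar_polydiscKernel a j (by simpa [hij.symm] using hz j) (hw j),
      Function.update_of_ne hij.symm]
  rw [kernelD, h, wirtinger_eq_of_hasDerivAt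
    ((hasDerivAt_polydiscKernel_left a i (hz i) (hw i)).const_mul _)]
  ring

theorem kernelDBar_kernelD_of_ne {i j : Fin m} (hij : i ≠ j) (hz : ∀ i, ‖z i‖ < 1)
    (hw : ∀ i, ‖w i‖ < 1) :
    kernelDBar i (kernelD j (polydiscKernel a)) z w =
      (a i * z i / (1 - z i * conj (w i))) * (a j * conj (w j) / (1 - z j * conj (w j))) *
        polydiscKernel a z w := by
  have h (t : ℂ) : kernelD j (polydiscKernel a) z (Function.update w i t) =
      a j * conj (w j) / (1 - z j * conj (w j)) *
        polydiscKernel a z (Function.update w i (conj (conj t))) := by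
    rw [kernelD_polydiscKernel a j (hz j) (by simpa [hij.symm] using hw j),
      Function.update_of_ne hij.symm, Complex.conj_conj]
  rw [kernelDBar, wirtingerBar_eq_of_hasDerivAt h
    ((hasDerivAt_polydiscKernel_right a i (hz i) (hw i)).const_mul _)]
  ring

theorem hasDerivAt_mul_div_one_sub (c : ℂ) {z w : ℂ} (h : 1 - z * w ≠ 0) :
    HasDerivAt (fun t => c * t / (1 - t * w)) (c / (1 - z * w) ^ 2) z := by
  have h1 : HasDerivAt (fun t => 1 - t * w) (-w) z := by
    simpa using ((hasDerivAt_id z).mul_const w).const_sub 1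
  have h2 := ((hasDerivAt_id' z).const_mul c).fun_div h1 h
  rwa [show c * 1 * (1 - z * w) - c * z * -w = c by ring] at h2

theorem kernelD_kernelDBar_self (i : Fin m) (hz : ∀ i, ‖z i‖ < 1) (hw : ∀ i, ‖w i‖ < 1) :
    kernelD i (kernelDBar i (polydiscKernel a)) z w =
      a i * (1 + a i * (z i * conj (w i))) / (1 - z i * conj (w i)) ^ 2 *
        polydiscKernel a z w := by
  -- The first derivative is known only for `‖t‖ < 1`, hence only near `z i`. For distinct indices
  -- the differentiated coordinate stays fixed, so equality there held for all `t`.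
  have h : (fun t => kernelDBar i (polydiscKernel a) (Function.update z i t) w) =ᶠ[nhds (z i)]
      fun t => a i * t / (1 - t * conj (w i)) * polydiscKernel a (Function.update z i t) w := by
    filter_upwards [eventually_norm_lt_one (hz i)] with t ht
    rw [kernelDBar_polydiscKernel a i (by simpa using ht) (hw i), Function.update_self]
  have hs := one_sub_mul_conj_ne_zero_of_norm_lt_one (hz i) (hw i)
  rw [kernelD, wirtinger_congr h, wirtinger_eq_of_hasDerivAt
    ((hasDerivAt_mul_div_one_sub (a i) hs).fun_mul
      (hasDerivAt_polydiscKernel_left a i (hz i) (hw i))), Function.update_eq_self]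
  field_simp

theorem kernelDBar_kernelD_self (i : Fin m) (hz : ∀ i, ‖z i‖ < 1) (hw : ∀ i, ‖w i‖ < 1) :
    kernelDBar i (kernelD i (polydiscKernel a)) z w =
      a i * (1 + a i * (z i * conj (w i))) / (1 - z i * conj (w i)) ^ 2 *
        polydiscKernel a z w := by
  have h : (fun t => kernelD i (polydiscKernel a) z (Function.update w i t)) =ᶠ[nhds (w i)]
      fun t => a i * conj t / (1 - conj t * z i) *
        polydiscKernel a z (Function.update w i (conj (conj t))) := by
    filter_upwards [eventually_norm_lt_one (hw i)] with t ht
    rw [kernelD_polydiscKernel a i (hz i) (by simpa using ht), Function.update_self,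
      Complex.conj_conj, mul_comm (z i)]
  have hs := one_sub_mul_conj_ne_zero_of_norm_lt_one (hz i) (hw i)
  have hs' : 1 - conj (w i) * z i ≠ 0 := by rwa [mul_comm]
  rw [kernelDBar, wirtingerBar_congr h, wirtingerBar_eq_of_hasDerivAt (fun _ => rfl)
    ((hasDerivAt_mul_div_one_sub (a i) hs').fun_mul
      (hasDerivAt_polydiscKernel_right a i (hz i) (hw i))), Complex.conj_conj,
    Function.update_eq_self, mul_comm (conj (w i))]
  field_simp

theorem polydiscKernel_const (z w : 𝔻) :
    polydiscKernel a (fun _ => (z : ℂ)) (fun _ => (w : ℂ)) =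
      (1 - (z : ℂ) * conj (w : ℂ)) ^ (-((∑ i, a i : ℝ) : ℂ)) := by
  have hs := one_sub_mul_conj_ne_zero z w
  have h (s : Finset (Fin m)) : ∏ i ∈ s, (1 - (z : ℂ) * conj (w : ℂ)) ^ (-(a i : ℂ)) =
      (1 - (z : ℂ) * conj (w : ℂ)) ^ (-((∑ i ∈ s, a i : ℝ) : ℂ)) := by
    classical
    induction s using Finset.induction_on with
    | empty => simp
    | insert i s hi ih =>
      rw [Finset.prod_insert hi, ih, Finset.sum_insert hi, ← cpow_add _ _ hs]
      congr 1
      push_cast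
      ring
  exact h _

theorem inner_diagonalKernel {n : ℕ} (G : (Fin m → ℂ) → (Fin m → ℂ) → Matrix (Fin n) (Fin n) ℂ)
    (z w : 𝔻) (u v : EuclideanSpace ℂ (Fin n)) :
    ⟪u, diagonalKernel G z w v⟫_ℂ =
      ∑ i, conj (u i) * ∑ j, G (fun _ => (z : ℂ)) (fun _ => (w : ℂ)) i j * v j := by
  rw [PiLp.inner_apply]
  refine Finset.sum_congr rfl fun i _ => ?_
  rw [RCLike.inner_apply, mul_comm]
  rfl

theorem inner_bidiscJetKernel (a b : ℝ) (z w : 𝔻) (u v : EuclideanSpace ℂ (Fin 2)) :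
    ⟪u, bidiscJetKernel a b z w v⟫_ℂ =
      (1 - (z : ℂ) * conj (w : ℂ)) ^ (-((a + b : ℝ) : ℂ)) *
      (conj (u 0) * v 0 + conj (u 0) * v 1 * (b * z / (1 - (z : ℂ) * conj (w : ℂ))) +
        conj (u 1) * v 0 * (b * conj (w : ℂ) / (1 - (z : ℂ) * conj (w : ℂ))) +
        conj (u 1) * v 1 * (b * (1 + b * (z * conj (w : ℂ))) /
          (1 - (z : ℂ) * conj (w : ℂ)) ^ 2)) := by
  have hz := z.norm_lt_one
  have hw := w.norm_lt_one
  rw [bidiscJetKernel, inner_diagonalKernel]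
  simp only [Fin.sum_univ_two, jetKernel, Matrix.of_apply, Fin.val_zero, Fin.val_one,
    Function.iterate_zero, Function.iterate_one, id]
  rw [kernelD_polydiscKernel _ 1 hz hw, kernelDBar_polydiscKernel _ 1 hz hw,
    kernelD_kernelDBar_self _ 1 (fun _ => hz) (fun _ => hw), polydiscKernel_const]
  simp only [Fin.sum_univ_two, Matrix.cons_val_zero, Matrix.cons_val_one]
  ring

theorem inner_tridiscJetKernel (α β γ : ℝ) (z w : 𝔻) (u v : EuclideanSpace ℂ (Fin 3)) :
    ⟪u, tridiscJetKernel α β γ z w v⟫_ℂ =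
      (1 - (z : ℂ) * conj (w : ℂ)) ^ (-((α + β + γ : ℝ) : ℂ)) *
      (conj (u 0) * v 0 +
        conj (u 0) * (β * v 1 + γ * v 2) * (z / (1 - (z : ℂ) * conj (w : ℂ))) +
        (β * conj (u 1) + γ * conj (u 2)) * v 0 *
          (conj (w : ℂ) / (1 - (z : ℂ) * conj (w : ℂ))) +
        (conj (u 1) * v 1 * (β * (1 + β * (z * conj (w : ℂ)))) +
          (conj (u 1) * v 2 + conj (u 2) * v 1) * (β * γ * (z * conj (w : ℂ))) +
          conj (u 2) * v 2 * (γ * (1 + γ * (z * conj (w : ℂ))))) /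
          (1 - (z : ℂ) * conj (w : ℂ)) ^ 2) := by
  have hz := z.norm_lt_one
  have hw := w.norm_lt_one
  rw [tridiscJetKernel, inner_diagonalKernel]
  simp only [Fin.sum_univ_three, jetOneOne, Matrix.transpose_apply, Matrix.of_apply,
    Matrix.cons_val]
  rw [kernelD_polydiscKernel _ 1 hz hw, kernelDBar_polydiscKernel _ 1 hz hw,
    kernelD_polydiscKernel _ 2 hz hw, kernelDBar_polydiscKernel _ 2 hz hw,
    kernelD_kernelDBar_self _ 1 (fun _ => hz) (fun _ => hw),
    kernelDBar_kernelD_self _ 2 (fun _ => hz) (fun _ => hw),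
    kernelD_kernelDBar_of_ne _ (by decide) (fun _ => hz) (fun _ => hw),
    kernelDBar_kernelD_of_ne _ (by decide) (fun _ => hz) (fun _ => hw), polydiscKernel_const]
  simp only [Fin.sum_univ_three, Matrix.cons_val]
  generalize 1 - (z : ℂ) * conj (w : ℂ) = s
  ring

end JetKernels

/-! ### Transformation of the kernels under disc automorphisms -/

section Covariance

theorem one_sub_re_pos {x : ℂ} (hx : ‖x‖ < 1) : 0 < (1 - x).re := by
  have := (Complex.re_le_norm x).trans_lt hx
  simpa using this

theorem abs_log_im_lt {x : ℂ} (hx : 0 < x.re) : |(log x).im| < Real.pi / 2 := by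
  rw [Complex.log_im, Complex.abs_arg_lt_pi_div_two_iff]
  exact Or.inl hx

theorem one_sub_discMobius_mul_conj {u a : ℂ} (hu : ‖u‖ = 1) (ha : ‖a‖ < 1) (z w : 𝔻) :
    (1 - discMobius u a hu ha z * conj (discMobius u a hu ha w : ℂ)) *
      ((1 - conj a * z) * (1 - a * conj (w : ℂ))) =
      (1 - conj a * a) * (1 - z * conj (w : ℂ)) := by
  have h1 := one_sub_conj_mul_ne_zero ha z.norm_lt_one
  have h2 := one_sub_conj_mul_ne_zero (a := conj a) (z := conj (w : ℂ)) (by simpa using ha)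
    (by simpa using w.norm_lt_one)
  rw [Complex.conj_conj] at h2
  have hu' := conj_mul_self_of_norm_eq_one hu
  rw [coe_discMobius, coe_discMobius]
  simp only [map_div₀, map_mul, map_sub, map_one, Complex.conj_conj]
  generalize conj (w : ℂ) = w' at *
  obtain ⟨A, hA⟩ : ∃ A, A = 1 - conj a * z := ⟨_, rfl⟩
  obtain ⟨B, hB⟩ : ∃ B, B = 1 - a * w' := ⟨_, rfl⟩
  rw [← hA] at h1 ⊢
  rw [← hB] at h2 ⊢
  field_simp
  rw [hA, hB]
  linear_combination (-(z - a) * (w' - conj a)) * hu'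

/-- The exponentials agree by `one_sub_discMobius_mul_conj`, so the two sides differ by a multiple
of `2πi`. Four of the logarithms have imaginary part below `π / 2` in absolute value and the fifth
is real, so the multiple is zero. Thus principal powers transform without a phase ambiguity. -/
theorem log_one_sub_discMobius {u a : ℂ} (hu : ‖u‖ = 1) (ha : ‖a‖ < 1) (z w : 𝔻) :
    log (1 - discMobius u a hu ha z * conj (discMobius u a hu ha w : ℂ)) +
      log (1 - conj a * z) + log (1 - a * conj (w : ℂ)) =
      log (1 - conj a * a) + log (1 - z * conj (w : ℂ)) := by
  set φz := discMobius u a hu ha z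
  set φw := discMobius u a hu ha w
  have n1 := norm_mul_conj_lt_one φz φw
  have n2 : ‖conj a * z‖ < 1 :=
    norm_mul_lt_one_of_norm_lt_one (by simpa using ha) z.norm_lt_one
  have n3 : ‖a * conj (w : ℂ)‖ < 1 :=
    norm_mul_lt_one_of_norm_lt_one ha (by simpa using w.norm_lt_one)
  have n4 : ‖conj a * a‖ < 1 := norm_mul_lt_one_of_norm_lt_one (by simpa using ha) ha
  have n5 := norm_mul_conj_lt_one z w
  have e : exp (log (1 - φz * conj (φw : ℂ)) + log (1 - conj a * z) +
      log (1 - a * conj (w : ℂ))) = exp (log (1 - conj a * a) + log (1 - z * conj (w : ℂ))) := by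
    rw [exp_add, exp_add, exp_add, exp_log (one_sub_ne_zero_of_norm_lt_one n1),
      exp_log (one_sub_ne_zero_of_norm_lt_one n2), exp_log (one_sub_ne_zero_of_norm_lt_one n3),
      exp_log (one_sub_ne_zero_of_norm_lt_one n4), exp_log (one_sub_ne_zero_of_norm_lt_one n5),
      mul_assoc]
    exact one_sub_discMobius_mul_conj hu ha z w
  obtain ⟨n, hn⟩ := exp_eq_exp_iff_exists_int.1 e
  have h0 : (log (1 - conj a * a)).im = 0 := by
    rw [Complex.conj_mul', ← Complex.ofReal_pow, ← Complex.ofReal_one, ← Complex.ofReal_sub,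
      Complex.log_im, Complex.arg_ofReal_of_nonneg]
    nlinarith [norm_nonneg a]
  have b1 := abs_lt.1 (abs_log_im_lt (one_sub_re_pos n1))
  have b2 := abs_lt.1 (abs_log_im_lt (one_sub_re_pos n2))
  have b3 := abs_lt.1 (abs_log_im_lt (one_sub_re_pos n3))
  have b5 := abs_lt.1 (abs_log_im_lt (one_sub_re_pos n5))
  have him := congrArg Complex.im hn
  simp only [add_im, h0] at him
  have hi : ((n : ℂ) * (2 * Real.pi * I)).im = n * (2 * Real.pi) := by simp
  rw [hi] at him
  have hpi := Real.pi_pos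
  have hn0 : n = 0 := by
    have l1 : (n : ℝ) < 1 := by
      by_contra! hc
      nlinarith
    have l2 : (-1 : ℝ) < n := by
      by_contra! hc
      nlinarith
    have l1' : n < 1 := by exact_mod_cast l1
    have l2' : -1 < n := by exact_mod_cast l2
    omega
  rw [hn, hn0]
  simp

/-- The cocycle is `(√(1 - |a|²) / (1 - a w̄)) ^ t`; the factor `1 - |a|²` is shared evenly between
`z` and `w`. -/
theorem exists_cocycle {u a : ℂ} (hu : ‖u‖ = 1) (ha : ‖a‖ < 1) (t : ℝ) :
    ∃ p : 𝔻 → ℂ, (∀ w, p w ≠ 0) ∧ ∀ z w : 𝔻, (1 - (z : ℂ) * conj (w : ℂ)) ^ (-(t : ℂ)) =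
      conj (p z) * p w *
      (1 - discMobius u a hu ha z * conj (discMobius u a hu ha w : ℂ)) ^ (-(t : ℂ)) := by
  refine ⟨fun w => exp (t * (log (1 - conj a * a) / 2 - log (1 - a * conj (w : ℂ)))),
    fun w => exp_ne_zero _, fun z w => ?_⟩
  have n2 : ‖a * conj (z : ℂ)‖ < 1 :=
    norm_mul_lt_one_of_norm_lt_one ha (by simpa using z.norm_lt_one)
  have harg : (1 - a * conj (z : ℂ)).arg ≠ Real.pi := by
    have h := abs_lt.1 (abs_log_im_lt (one_sub_re_pos n2))
    rw [Complex.log_im] at h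
    linarith [h.2, Real.pi_pos]
  have harg' : (1 - conj a * a).arg ≠ Real.pi := by
    have h := abs_lt.1 (abs_log_im_lt (one_sub_re_pos
      (norm_mul_lt_one_of_norm_lt_one (z := conj a) (w := a) (by simpa using ha) ha)))
    rw [Complex.log_im] at h
    linarith [h.2, Real.pi_pos]
  rw [cpow_def_of_ne_zero (one_sub_mul_conj_ne_zero z w),
    cpow_def_of_ne_zero (one_sub_mul_conj_ne_zero _ _), ← exp_conj, ← exp_add, ← exp_add]
  congr 1
  simp only [map_mul, map_sub, map_div₀, Complex.conj_ofReal, ← log_conj _ harg,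
    ← log_conj _ harg', map_one, Complex.conj_conj, map_ofNat]
  have := log_one_sub_discMobius hu ha z w
  rw [mul_comm a (conj a)]
  linear_combination (t : ℂ) * this

/-- The derivative of an automorphism of the disc, conjugated. -/
def conjDerivMobius (u a : ℂ) (w : 𝔻) : ℂ :=
  conj u * (1 - conj a * a) / (1 - a * conj (w : ℂ)) ^ 2

theorem one_sub_mul_conj_coe_ne_zero {a : ℂ} (ha : ‖a‖ < 1) (w : 𝔻) :
    1 - a * conj (w : ℂ) ≠ 0 :=
  one_sub_mul_conj_ne_zero_of_norm_lt_one ha w.norm_lt_one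

theorem conjDerivMobius_ne_zero {u a : ℂ} (hu : ‖u‖ = 1) (ha : ‖a‖ < 1) (w : 𝔻) :
    conjDerivMobius u a w ≠ 0 := by
  have hu0 : u ≠ 0 := by
    rintro rfl
    simp at hu
  exact div_ne_zero (mul_ne_zero (by simpa using hu0) (one_sub_conj_mul_ne_zero ha ha))
    (pow_ne_zero _ (one_sub_mul_conj_coe_ne_zero ha w))

theorem one_sub_discMobius_mul_conj_eq {u a : ℂ} (hu : ‖u‖ = 1) (ha : ‖a‖ < 1) (z w : 𝔻) :
    1 - discMobius u a hu ha z * conj (discMobius u a hu ha w : ℂ) =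
      (1 - conj a * a) * (1 - z * conj (w : ℂ)) /
        ((1 - conj a * z) * (1 - a * conj (w : ℂ))) := by
  rw [eq_div_iff (mul_ne_zero (one_sub_conj_mul_ne_zero ha z.norm_lt_one)
    (one_sub_mul_conj_coe_ne_zero ha w)), one_sub_discMobius_mul_conj]

/-- This is the `w̄`-derivative of `log_one_sub_discMobius`, up to sign, checked algebraically.
Differentiating once more in `z` gives the rule of `one_div_sq_one_sub_discMobius`. -/
theorem div_one_sub_discMobius {u a : ℂ} (hu : ‖u‖ = 1) (ha : ‖a‖ < 1) (z w : 𝔻) :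
    (z : ℂ) / (1 - z * conj (w : ℂ)) = a / (1 - a * conj (w : ℂ)) + conjDerivMobius u a w *
      (discMobius u a hu ha z /
        (1 - discMobius u a hu ha z * conj (discMobius u a hu ha w : ℂ))) := by
  have h1 := one_sub_conj_mul_ne_zero ha z.norm_lt_one
  have h2 := one_sub_mul_conj_coe_ne_zero ha w
  have h3 := one_sub_mul_conj_ne_zero z w
  have h4 := one_sub_conj_mul_ne_zero ha ha
  have hu' := conj_mul_self_of_norm_eq_one hu
  rw [one_sub_discMobius_mul_conj_eq, conjDerivMobius, coe_discMobius]
  generalize conj (w : ℂ) = w' at *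
  generalize 1 - conj a * a = r at *
  generalize 1 - conj a * (z : ℂ) = A at *
  obtain ⟨B, hB⟩ : ∃ B, B = 1 - a * w' := ⟨_, rfl⟩
  obtain ⟨s, hs⟩ : ∃ s, s = 1 - z * w' := ⟨_, rfl⟩
  rw [← hB] at h2 ⊢
  rw [← hs] at h3 ⊢
  field_simp
  rw [hB, hs]
  linear_combination (-(z - a)) * hu'

theorem conj_div_one_sub_discMobius {u a : ℂ} (hu : ‖u‖ = 1) (ha : ‖a‖ < 1) (z w : 𝔻) :
    conj (w : ℂ) / (1 - z * conj (w : ℂ)) = conj (a / (1 - a * conj (z : ℂ))) +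
      conj (conjDerivMobius u a z) * (conj (discMobius u a hu ha w : ℂ) /
        (1 - discMobius u a hu ha z * conj (discMobius u a hu ha w : ℂ))) := by
  have h := congrArg conj (div_one_sub_discMobius hu ha w z)
  simp only [map_add, map_mul, map_div₀, map_sub, map_one, Complex.conj_conj] at h ⊢
  rw [mul_comm (conj (w : ℂ)) (z : ℂ), mul_comm (conj (discMobius u a hu ha w : ℂ))] at h
  exact h

theorem one_div_sq_one_sub_discMobius {u a : ℂ} (hu : ‖u‖ = 1) (ha : ‖a‖ < 1) (z w : 𝔻) :
    1 / (1 - z * conj (w : ℂ)) ^ 2 = conj (conjDerivMobius u a z) * conjDerivMobius u a w *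
      (1 / (1 - discMobius u a hu ha z * conj (discMobius u a hu ha w : ℂ)) ^ 2) := by
  have h1 := one_sub_conj_mul_ne_zero ha z.norm_lt_one
  have h2 := one_sub_mul_conj_coe_ne_zero ha w
  have h3 := one_sub_mul_conj_ne_zero z w
  have h4 := one_sub_conj_mul_ne_zero ha ha
  have hu' := conj_mul_self_of_norm_eq_one hu
  rw [one_sub_discMobius_mul_conj_eq, conjDerivMobius, conjDerivMobius]
  simp only [map_mul, map_div₀, map_sub, map_one, map_pow, Complex.conj_conj]
  rw [mul_comm a (conj a)]
  generalize 1 - conj a * a = r at *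
  generalize 1 - conj a * (z : ℂ) = A at *
  generalize 1 - a * conj (w : ℂ) = B at *
  generalize 1 - z * conj (w : ℂ) = s at *
  field_simp
  linear_combination (-1 : ℂ) * hu'

theorem inner_discKernel (t : ℝ) (z w : 𝔻) (u v : ℂ) : ⟪u, discKernel t z w v⟫_ℂ =
    (1 - (z : ℂ) * conj (w : ℂ)) ^ (-(t : ℂ)) * (conj u * v) := by
  simp [discKernel, RCLike.inner_apply]
  ring

theorem isMobiusCovariant_discKernel (t : ℝ) : IsMobiusCovariant (discKernel t) := by
  intro u a hu ha
  obtain ⟨p, hp, hpq⟩ := exists_cocycle hu ha t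
  refine ⟨fun w => p w • 1, fun w y => ⟨(p w)⁻¹ * y, ?_⟩, fun z w x y => ?_⟩
  · simp [hp w]
  · rw [inner_discKernel, inner_discKernel, hpq]
    simp
    ring

/-- Completing the square leaves only the functions `z / s`, `w̄ / s` and `1 / s²` of `s = 1 - z
w̄`, whose transformation rules are known. The cocycle `J` for the jet kernel can be read off, and
on the diagonal positivity is visible. -/
theorem inner_bidiscJetKernel' (a b : ℝ) (z w : 𝔻) (u v : EuclideanSpace ℂ (Fin 2)) :
    ⟪u, bidiscJetKernel a b z w v⟫_ℂ =
      (1 - (z : ℂ) * conj (w : ℂ)) ^ (-((a + b : ℝ) : ℂ)) *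
      ((conj (u 0) + conj (w : ℂ) / (1 - (z : ℂ) * conj (w : ℂ)) * (b * conj (u 1))) *
        (v 0 + z / (1 - (z : ℂ) * conj (w : ℂ)) * (b * v 1)) +
        1 / (1 - (z : ℂ) * conj (w : ℂ)) ^ 2 * (b * conj (u 1) * v 1)) := by
  rw [inner_bidiscJetKernel]
  generalize (1 - (z : ℂ) * conj (w : ℂ)) = s
  ring

theorem inner_tridiscJetKernel' (α β γ : ℝ) (z w : 𝔻) (u v : EuclideanSpace ℂ (Fin 3)) :
    ⟪u, tridiscJetKernel α β γ z w v⟫_ℂ =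
      (1 - (z : ℂ) * conj (w : ℂ)) ^ (-((α + β + γ : ℝ) : ℂ)) *
      ((conj (u 0) + conj (w : ℂ) / (1 - (z : ℂ) * conj (w : ℂ)) *
          (β * conj (u 1) + γ * conj (u 2))) *
        (v 0 + z / (1 - (z : ℂ) * conj (w : ℂ)) * (β * v 1 + γ * v 2)) +
        1 / (1 - (z : ℂ) * conj (w : ℂ)) ^ 2 *
          (β * conj (u 1) * v 1 + γ * conj (u 2) * v 2)) := by
  rw [inner_tridiscJetKernel]
  generalize (1 - (z : ℂ) * conj (w : ℂ)) = s
  ring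

theorem isMobiusCovariant_bidiscJetKernel (α b : ℝ) :
    IsMobiusCovariant (bidiscJetKernel α b) := by
  intro u a hu ha
  obtain ⟨p, hp, hpq⟩ := exists_cocycle hu ha (α + b)
  let c (w : 𝔻) := conjDerivMobius u a w
  let m (w : 𝔻) := a / (1 - a * conj (w : ℂ))
  have hc (w : 𝔻) : c w ≠ 0 := conjDerivMobius_ne_zero hu ha w
  let J (w : 𝔻) : EuclideanSpace ℂ (Fin 2) →L[ℂ] EuclideanSpace ℂ (Fin 2) :=
    Matrix.toEuclideanCLM (𝕜 := ℂ) !![p w, p w * (b * m w); 0, p w * c w]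
  have hJ0 (w : 𝔻) (v : EuclideanSpace ℂ (Fin 2)) : J w v 0 = p w * (v 0 + m w * (b * v 1)) := by
    simp [J, Matrix.ofLp_toEuclideanCLM, Matrix.mulVec, dotProduct, Fin.sum_univ_two]
    ring
  have hJ1 (w : 𝔻) (v : EuclideanSpace ℂ (Fin 2)) : J w v 1 = p w * (c w * v 1) := by
    simp [J, Matrix.ofLp_toEuclideanCLM, Matrix.mulVec, dotProduct, Fin.sum_univ_two]
    ring
  refine ⟨J, fun w y => ⟨!₂[y 0 / p w - m w * (b * (y 1 / (p w * c w))), y 1 / (p w * c w)], ?_⟩,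
    fun z w x y => ?_⟩
  · have h1 := hp w
    have h2 := hc w
    ext i
    fin_cases i
    · rw [Fin.zero_eta, hJ0]
      simp
      field_simp
    · rw [Fin.mk_one, hJ1]
      simp
      field_simp
  · rw [inner_bidiscJetKernel', inner_bidiscJetKernel', hpq, div_one_sub_discMobius hu ha,
      conj_div_one_sub_discMobius hu ha, one_div_sq_one_sub_discMobius hu ha, hJ0, hJ0, hJ1, hJ1]
    simp only [map_mul, map_add, Complex.conj_ofReal, c, m]
    ring

theorem isMobiusCovariant_tridiscJetKernel (α β γ : ℝ) :
    IsMobiusCovariant (tridiscJetKernel α β γ) := by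
  intro u a hu ha
  obtain ⟨p, hp, hpq⟩ := exists_cocycle hu ha (α + β + γ)
  let c (w : 𝔻) := conjDerivMobius u a w
  let m (w : 𝔻) := a / (1 - a * conj (w : ℂ))
  have hc (w : 𝔻) : c w ≠ 0 := conjDerivMobius_ne_zero hu ha w
  let J (w : 𝔻) : EuclideanSpace ℂ (Fin 3) →L[ℂ] EuclideanSpace ℂ (Fin 3) :=
    Matrix.toEuclideanCLM (𝕜 := ℂ)
      !![p w, p w * (β * m w), p w * (γ * m w); 0, p w * c w, 0; 0, 0, p w * c w]
  have hJ0 (w : 𝔻) (v : EuclideanSpace ℂ (Fin 3)) :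
      J w v 0 = p w * (v 0 + m w * (β * v 1 + γ * v 2)) := by
    simp [J, Matrix.ofLp_toEuclideanCLM, Matrix.mulVec, dotProduct, Fin.sum_univ_three]
    ring
  have hJ1 (w : 𝔻) (v : EuclideanSpace ℂ (Fin 3)) : J w v 1 = p w * (c w * v 1) := by
    simp [J, Matrix.ofLp_toEuclideanCLM, Matrix.mulVec, dotProduct, Fin.sum_univ_three]
    ring
  have hJ2 (w : 𝔻) (v : EuclideanSpace ℂ (Fin 3)) : J w v 2 = p w * (c w * v 2) := by
    simp [J, Matrix.ofLp_toEuclideanCLM, Matrix.mulVec, dotProduct, Fin.sum_univ_three]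
    ring
  refine ⟨J, fun w y => ⟨!₂[y 0 / p w - m w * (β * (y 1 / (p w * c w)) +
    γ * (y 2 / (p w * c w))), y 1 / (p w * c w), y 2 / (p w * c w)], ?_⟩,
    fun z w x y => ?_⟩
  · have h1 := hp w
    have h2 := hc w
    ext i
    fin_cases i
    · rw [Fin.zero_eta, hJ0]
      simp
      field_simp
    · rw [Fin.mk_one, hJ1]
      simp
      field_simp
    · show J w _ 2 = y 2
      rw [hJ2]
      simp
      field_simp
  · rw [inner_tridiscJetKernel', inner_tridiscJetKernel', hpq, div_one_sub_discMobius hu ha,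
      conj_div_one_sub_discMobius hu ha, one_div_sq_one_sub_discMobius hu ha, hJ0, hJ0, hJ1, hJ1,
      hJ2, hJ2]
    simp only [map_mul, map_add, Complex.conj_ofReal, c, m]
    ring

end Covariance

/-! ### Nondegeneracy on the diagonal and triviality of the commutant -/

section Irreducibility

theorem one_sub_mul_conj_cpow_ne_zero (t : ℝ) (z w : 𝔻) :
    (1 - (z : ℂ) * conj (w : ℂ)) ^ (-(t : ℂ)) ≠ 0 := by
  rw [cpow_def_of_ne_zero (one_sub_mul_conj_ne_zero z w)]
  exact exp_ne_zero _

theorem discKernel_diag_injective (t : ℝ) (w : 𝔻) (v : ℂ) (h : discKernel t w w v = 0) :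
    v = 0 := by
  have h1 := inner_discKernel t w w 1 v
  rw [h, inner_zero_right, eq_comm,
    mul_eq_zero_iff_left (one_sub_mul_conj_cpow_ne_zero t w w)] at h1
  simpa using h1

theorem discKernel_commutant (t : ℝ) (p : 𝔻 → ℂ →ₗ[ℂ] ℂ)
    (hp : ∀ z w u v, ⟪u, discKernel t z w (p w v)⟫_ℂ = ⟪p z u, discKernel t z w v⟫_ℂ) :
    ∃ c : ℂ, ∀ w v, p w v = c • v := by
  refine ⟨conj (p 0 1), fun w v => ?_⟩
  have h := hp 0 w 1 1
  rw [inner_discKernel, inner_discKernel] at h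
  have h1 : p w 1 = conj (p 0 1) := by
    simpa [one_sub_mul_conj_cpow_ne_zero] using h
  rw [← h1]
  have h2 := (p w).map_smul v 1
  rw [smul_eq_mul, mul_one] at h2
  rw [h2, smul_eq_mul, smul_eq_mul, mul_comm]

theorem bidiscJetKernel_diag_injective (a : ℝ) {b : ℝ} (hb : 0 < b) (w : 𝔻)
    (v : EuclideanSpace ℂ (Fin 2)) (h : bidiscJetKernel a b w w v = 0) : v = 0 := by
  have h1 := inner_bidiscJetKernel' a b w w v v
  have hs : (1 - (w : ℂ) * conj (w : ℂ)) = ((1 - normSq w : ℝ) : ℂ) := by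
    rw [Complex.mul_conj]; push_cast; rfl
  have hs0 : 0 < 1 - normSq (w : ℂ) := by linarith [w.normSq_lt_one]
  rw [h, inner_zero_right, eq_comm,
    mul_eq_zero_iff_left (one_sub_mul_conj_cpow_ne_zero (a + b) w w), hs] at h1
  set s := 1 - normSq (w : ℂ)
  set y := v 0 + w / (s : ℂ) * (b * v 1) with hy
  have hy' : conj (v 0) + conj (w : ℂ) / (s : ℂ) * (b * conj (v 1)) = conj y := by
    simp [hy]
  have h2 : ((normSq y + 1 / s ^ 2 * (b * normSq (v 1)) : ℝ) : ℂ) = 0 := by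
    rw [← h1, hy']
    push_cast
    rw [mul_assoc (b : ℂ) (conj (v 1)), ← Complex.normSq_eq_conj_mul_self,
      ← Complex.normSq_eq_conj_mul_self]
  have h3 : normSq y + 1 / s ^ 2 * (b * normSq (v 1)) = 0 := by exact_mod_cast h2
  have h4 := normSq_nonneg y
  have h5 : 0 ≤ 1 / s ^ 2 * (b * normSq (v 1)) := by
    have := normSq_nonneg (v 1)
    positivity
  have h6 : v 1 = 0 := by
    have h7 : 1 / s ^ 2 * (b * normSq (v 1)) = 0 := by linarith
    simpa [hs0.ne', hb.ne'] using h7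
  have h8 : y = 0 := normSq_eq_zero.1 (by linarith)
  rw [hy, h6, mul_zero, mul_zero, add_zero] at h8
  ext i
  fin_cases i
  · exact h8
  · exact h6

/-- Putting `z = 0` expresses every `p w` as a polynomial in `w̄` in the entries of `p 0`. The
relation at other points then forces `p 0` to be scalar: first its off-diagonal entries vanish, then
the diagonal ones agree. -/
theorem bidiscJetKernel_commutant (a : ℝ) {b : ℝ} (hb : 0 < b)
    (p : 𝔻 → EuclideanSpace ℂ (Fin 2) →ₗ[ℂ] EuclideanSpace ℂ (Fin 2))
    (hp : ∀ z w u v, ⟪u, bidiscJetKernel a b z w (p w v)⟫_ℂ =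
      ⟪p z u, bidiscJetKernel a b z w v⟫_ℂ) :
    ∃ c : ℂ, ∀ w v, p w v = c • v := by
  have hb0 : (b : ℂ) ≠ 0 := by exact_mod_cast hb.ne'
  have hb1 : (b : ℂ) + 1 ≠ 0 := by exact_mod_cast (by positivity : b + 1 ≠ 0)
  have key (z w : 𝔻) (u v : EuclideanSpace ℂ (Fin 2)) :
      (conj (u 0) + conj (w : ℂ) / (1 - (z : ℂ) * conj (w : ℂ)) * (b * conj (u 1))) *
        (p w v 0 + z / (1 - (z : ℂ) * conj (w : ℂ)) * (b * p w v 1)) +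
        1 / (1 - (z : ℂ) * conj (w : ℂ)) ^ 2 * (b * conj (u 1) * p w v 1) =
      (conj (p z u 0) + conj (w : ℂ) / (1 - (z : ℂ) * conj (w : ℂ)) * (b * conj (p z u 1))) *
        (v 0 + z / (1 - (z : ℂ) * conj (w : ℂ)) * (b * v 1)) +
        1 / (1 - (z : ℂ) * conj (w : ℂ)) ^ 2 * (b * conj (p z u 1) * v 1) := by
    have h := hp z w u v
    rw [inner_bidiscJetKernel', inner_bidiscJetKernel'] at h
    exact mul_left_cancel₀ (one_sub_mul_conj_cpow_ne_zero (a + b) z w) h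
  let e₀ : EuclideanSpace ℂ (Fin 2) := EuclideanSpace.single 0 1
  let e₁ : EuclideanSpace ℂ (Fin 2) := EuclideanSpace.single 1 1
  have e00 : e₀ 0 = 1 := by simp [e₀]
  have e01 : e₀ 1 = 0 := by simp [e₀]
  have e10 : e₁ 0 = 0 := by simp [e₁]
  have e11 : e₁ 1 = 1 := by simp [e₁]
  set A := p 0 e₀ 0
  set C := p 0 e₀ 1
  set B := p 0 e₁ 0
  set D := p 0 e₁ 1
  have k00 (w : 𝔻) := key 0 w e₀ e₀
  have k01 (w : 𝔻) := key 0 w e₀ e₁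
  have k10 (w : 𝔻) := key 0 w e₁ e₀
  have k11 (w : 𝔻) := key 0 w e₁ e₁
  simp only [e00, e01, e10, e11, UnitDisc.coe_zero, map_one, map_zero, zero_mul, sub_zero,
    div_one, mul_zero, add_zero, zero_add, one_mul, mul_one, one_pow]
    at k00 k01 k10 k11
  -- hermitian symmetry at the origin
  have hA : conj A = A := by simpa using (k00 0).symm
  have hB : B = b * conj C := by simpa using k01 0
  have hD : conj D = D := by
    have := k11 0
    simp only [UnitDisc.coe_zero, map_zero, zero_mul, zero_add] at this
    exact (mul_left_cancel₀ hb0 this).symm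
  have hBc : conj B = b * C := by rw [hB]; simp
  have p00 (w : 𝔻) : p w e₀ 0 = A + b * conj (w : ℂ) * conj C := by
    rw [k00, hA]; ring
  have p01 (w : 𝔻) : p w e₁ 0 = b * conj C := by rw [k01]
  have p10 (w : 𝔻) : p w e₀ 1 =
      C + conj (w : ℂ) * (D - A) - b * conj (w : ℂ) ^ 2 * conj C := by
    have := k10 w
    rw [p00, hBc, hD] at this
    apply mul_left_cancel₀ hb0
    linear_combination this
  have p11 (w : 𝔻) : p w e₁ 1 = D - b * conj (w : ℂ) * conj C := by
    have := k11 w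
    rw [p01, hD] at this
    apply mul_left_cancel₀ hb0
    linear_combination this
  have hC (z w : 𝔻) (hz : (z : ℂ) ≠ 0) (hw : (w : ℂ) ≠ 0) : z * C = conj (w : ℂ) * conj C := by
    have h := key z w e₀ e₀
    have hs := one_sub_mul_conj_ne_zero z w
    have hw' : conj (w : ℂ) ≠ 0 := by simpa using hw
    simp only [e00, e01, p00, p10, map_one, map_zero, mul_zero, add_zero, zero_mul, one_mul,
      mul_one, map_add, map_mul, map_sub, map_pow, Complex.conj_conj, Complex.conj_ofReal, hA, hD]
      at h
    obtain ⟨s, hsd⟩ : ∃ s, s = 1 - (z : ℂ) * conj (w : ℂ) := ⟨_, rfl⟩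
    rw [← hsd] at h hs
    field_simp at h
    rw [hsd] at h
    have h' : (z * conj (w : ℂ) * (b + 1)) * (z * C) =
        (z * conj (w : ℂ) * (b + 1)) * (conj (w : ℂ) * conj C) := by
      apply mul_left_cancel₀ hb0
      linear_combination h
    exact mul_left_cancel₀ (mul_ne_zero (mul_ne_zero hz hw') hb1) h'
  have hC0 : C = 0 := by
    -- Two values of `z` against the same `w`: the right side of `hC` does not change, while `z * C`
    -- does unless `C = 0`.
    have h1 := hC (UnitDisc.mk (1 / 2) (by norm_num)) (UnitDisc.mk (1 / 2) (by norm_num))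
      (by norm_num) (by norm_num)
    have h2 := hC (UnitDisc.mk (I / 2) (by norm_num)) (UnitDisc.mk (1 / 2) (by norm_num))
      (by simp) (by norm_num)
    rw [UnitDisc.coe_mk] at h1 h2
    rw [UnitDisc.coe_mk] at h2
    rw [← h1] at h2
    have h3 : (I - 1) * C = 0 := by linear_combination 2 * h2
    rcases mul_eq_zero.1 h3 with h4 | h4
    · have := congrArg Complex.im h4
      simp at this
    · exact h4
  have hDA : D = A := by
    -- With `C = 0`, the single pair `z = w = 1 / 2` reduces the mixed entry to a nonzero multiple
    -- of `b (b + 1) (D - A)`.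
    have hlt : ‖(1 / 2 : ℂ)‖ < 1 := by norm_num
    have h := key (UnitDisc.mk (1 / 2) hlt) (UnitDisc.mk (1 / 2) hlt) e₀ e₁
    simp only [e00, e01, e10, e11, p00, p10, p01, p11, hC0, map_one, map_zero, mul_zero, add_zero,
      zero_mul, one_mul, mul_one, map_mul, map_sub, hA, hD, zero_add,
      sub_zero, UnitDisc.coe_mk, map_div₀, map_ofNat] at h
    have h' : ((b : ℂ) + 1) * (D - A) = 0 := by
      apply mul_left_cancel₀ hb0
      norm_num at h
      linear_combination (-9 / 2) * h
    exact sub_eq_zero.1 ((mul_eq_zero.1 h').resolve_left hb1)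
  refine ⟨A, fun w v => ?_⟩
  have hv : v = v 0 • e₀ + v 1 • e₁ := by
    ext i
    fin_cases i <;> simp [e₀, e₁]
  have hpv : p w v = v 0 • p w e₀ + v 1 • p w e₁ := by
    conv_lhs => rw [hv]
    rw [map_add, map_smul, map_smul]
  ext i
  rw [hpv]
  fin_cases i
  · simp [p00, p01, hC0, mul_comm]
  · simp [p10, p11, hC0, hDA, mul_comm]

end Irreducibility

/-! ### Splitting the tridisc jet kernel -/

section Models

variable {α b : ℝ} (hα : 0 < α) (hb : 0 < b)

theorem kernelModel_bidiscJetKernel :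
    KernelModel (bidiscJetKernel α b) (bidiscVec α b hα hb) where
  inner_apply z w u v := by rw [inner_bidiscVec, inner_bidiscJetKernel]
  total _ hx := total_bidiscVec hα hb hx

/-- The map `v ↦ (v₀, (β v₁ + γ v₂) / (β + γ))`. -/
def jetSum (β γ : ℝ) : EuclideanSpace ℂ (Fin 3) →L[ℂ] EuclideanSpace ℂ (Fin 2) :=
  (coordCLM 0).smulRight (EuclideanSpace.single 0 (1 : ℂ)) +
    (((β / (β + γ) : ℝ) : ℂ) • coordCLM 1 + ((γ / (β + γ) : ℝ) : ℂ) • coordCLM 2).smulRight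
      (EuclideanSpace.single 1 (1 : ℂ))

/-- The map `v ↦ √(β γ / (β + γ)) (v₁ - v₂)`. -/
def jetDifference (β γ : ℝ) : EuclideanSpace ℂ (Fin 3) →L[ℂ] ℂ :=
  ((√(β * γ / (β + γ)) : ℝ) : ℂ) • (coordCLM 1 - coordCLM 2)

theorem jetSum_apply_zero (β γ : ℝ) (v : EuclideanSpace ℂ (Fin 3)) : jetSum β γ v 0 = v 0 := by
  simp [jetSum]

theorem jetSum_apply_one (β γ : ℝ) (v : EuclideanSpace ℂ (Fin 3)) :
    jetSum β γ v 1 = (β * v 1 + γ * v 2) / (β + γ) := by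
  simp [jetSum]
  ring

theorem jetDifference_apply (β γ : ℝ) (v : EuclideanSpace ℂ (Fin 3)) :
    jetDifference β γ v = ((√(β * γ / (β + γ)) : ℝ) : ℂ) * (v 1 - v 2) := rfl

variable {β γ : ℝ} (hβ : 0 < β) (hγ : 0 < γ)

include hβ hγ in
-- Two numbers with weighted mean `y` and difference `d` are `y + γ d / (β + γ)` and `y - β d / (β +
-- γ)`.
theorem jet_surjective : Function.Surjective fun v => (jetSum β γ v, jetDifference β γ v) := by
  rintro ⟨y, c⟩
  have hν : ((√(β * γ / (β + γ)) : ℝ) : ℂ) ≠ 0 := by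
    exact_mod_cast (Real.sqrt_pos.2 (by positivity)).ne'
  have hs : (β : ℂ) + γ ≠ 0 := by exact_mod_cast (add_pos hβ hγ).ne'
  refine ⟨!₂[y 0, y 1 + γ / (β + γ) * (c / (√(β * γ / (β + γ)) : ℝ)),
    y 1 - β / (β + γ) * (c / (√(β * γ / (β + γ)) : ℝ))], Prod.ext ?_ ?_⟩
  · ext i
    fin_cases i
    · exact jetSum_apply_zero _ _ _
    · refine (jetSum_apply_one _ _ _).trans ?_
      simp only [Matrix.cons_val, Fin.mk_one]
      field_simp
      ring
  · simp only [jetDifference_apply]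
    simp only [Matrix.cons_val]
    field_simp
    ring

include hβ hγ in
-- In the completed square the linear factors see only the weighted mean, and the last term splits
-- by `β ū₁ v₁ + γ ū₂ v₂ = (β + γ) (mean u)‾ (mean v) + βγ / (β + γ) (u₁ - u₂)‾ (v₁ - v₂)`. The
-- remaining `1 / s²` raises the scalar exponent by two.
theorem inner_tridiscJetKernel_eq_add (α : ℝ) (z w : 𝔻) (u v : EuclideanSpace ℂ (Fin 3)) :
    ⟪u, tridiscJetKernel α β γ z w v⟫_ℂ =
      ⟪jetSum β γ u, bidiscJetKernel α (β + γ) z w (jetSum β γ v)⟫_ℂ +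
      ⟪jetDifference β γ u, discKernel (α + β + γ + 2) z w (jetDifference β γ v)⟫_ℂ := by
  have hν : ((√(β * γ / (β + γ)) : ℝ) : ℂ) * ((√(β * γ / (β + γ)) : ℝ) : ℂ) =
      ((β * γ / (β + γ) : ℝ) : ℂ) := by
    exact_mod_cast Real.mul_self_sqrt (by positivity)
  have hs := one_sub_mul_conj_ne_zero z w
  have hβγ : (β : ℂ) + γ ≠ 0 := by exact_mod_cast (add_pos hβ hγ).ne'
  rw [inner_tridiscJetKernel', inner_bidiscJetKernel', inner_discKernel, jetSum_apply_zero,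
    jetSum_apply_zero, jetSum_apply_one, jetSum_apply_one, jetDifference_apply,
    jetDifference_apply, ← add_assoc,
    show α + β + γ + 2 = α + β + γ + 1 + 1 by ring, one_sub_cpow_add_one _
      (norm_mul_conj_lt_one z w), one_sub_cpow_add_one _ (norm_mul_conj_lt_one z w)]
  simp only [map_mul, map_sub, map_add, map_div₀, Complex.conj_ofReal]
  generalize ((√(β * γ / (β + γ)) : ℝ) : ℂ) = ν at *
  generalize (1 - (z : ℂ) * conj (w : ℂ)) ^ (-((α + β + γ : ℝ) : ℂ)) = q
  generalize (1 - (z : ℂ) * conj (w : ℂ)) = s at *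
  have hν' : ν ^ 2 = β * γ / (β + γ) := by rw [sq, hν]; push_cast; rfl
  push_cast
  field_simp at hν' ⊢
  linear_combination (-q * (conj (u 1) - conj (u 2)) * (v 1 - v 2)) * hν'

end Models

/-! ### Transfer from models to reproducing kernel Hilbert spaces -/

section FunctionSpaces

variable {V E H : Type*} [NormedAddCommGroup V] [InnerProductSpace ℂ V] [CompleteSpace V]
  [NormedAddCommGroup E] [InnerProductSpace ℂ E] [CompleteSpace E]
  [NormedAddCommGroup H] [InnerProductSpace ℂ H] [CompleteSpace H] [RKHS ℂ H 𝔻 V]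
  {K : Matrix 𝔻 𝔻 (V →L[ℂ] V)} {k : 𝔻 → V →L[ℂ] E}

/-- The kernel functions of `H` form a model too, so `T` is carried to `H` by a unitary; the adjoint
of the transported operator is multiplication by the coordinate, which is thereby bounded. -/
theorem KernelModel.exists_mulByCoord (h : KernelModel K k) (hK : RKHS.kernel H = K)
    {T : E →L[ℂ] E} (hT : ∀ w v, T (k w v) = conj (w : ℂ) • k w v) :
    ∃ M : H →L[ℂ] H, IsMulByCoord M ∧
      UnitarilyEquivalent (ContinuousLinearMap.adjoint M) T ∧
      ∀ w v, ContinuousLinearMap.adjoint M (RKHS.kerFun H w v) =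
        conj (w : ℂ) • RKHS.kerFun H w v := by
  subst hK
  obtain ⟨U, hU⟩ := (kernelModel_kerFun H).exists_linearIsometryEquiv h
  let S : H →L[ℂ] H := (U.symm : E →L[ℂ] H) ∘L T ∘L (U : H →L[ℂ] E)
  have hS (w : 𝔻) (v : V) : S (RKHS.kerFun H w v) = conj (w : ℂ) • RKHS.kerFun H w v := by
    change U.symm (T (U (RKHS.kerFun H w v))) = _
    rw [hU, hT, map_smul, ← hU, U.symm_apply_apply]
  refine ⟨ContinuousLinearMap.adjoint S, isMulByCoord_adjoint hS, ?_, ?_⟩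
  · rw [ContinuousLinearMap.adjoint_adjoint]
    exact ⟨U, fun x => by simp [S]⟩
  · rwa [ContinuousLinearMap.adjoint_adjoint]

theorem KernelModel.consistsOfHolomorphic [FiniteDimensional ℂ V] (h : KernelModel K k) (hK : RKHS.kernel H = K)
    (hk : ∀ (x : E) (v : V), ∃ F : ℂ → ℂ, DifferentiableOn ℂ F (Metric.ball 0 1) ∧
      ∀ z : 𝔻, F z = ⟪k z v, x⟫_ℂ) : ConsistsOfHolomorphic H := by
  subst hK
  obtain ⟨U, hU⟩ := (kernelModel_kerFun H).exists_linearIsometryEquiv h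
  refine consistsOfHolomorphic_of_kerFun fun f v => ?_
  obtain ⟨F, hF, hF'⟩ := hk (U f) v
  exact ⟨F, hF, fun z => by rw [hF', ← hU, U.inner_map_map]⟩

theorem KernelModel.separableSpace [TopologicalSpace.SeparableSpace E] (h : KernelModel K k)
    (hK : RKHS.kernel H = K) : TopologicalSpace.SeparableSpace H := by
  subst hK
  obtain ⟨U, -⟩ := (kernelModel_kerFun H).exists_linearIsometryEquiv h
  exact U.symm.surjective.denseRange.separableSpace U.symm.continuous

end FunctionSpaces

/-! ### Cowen–Douglas class and homogeneity in the function space -/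

section Decomposition

instance WithLp.separableSpace_prod {E F : Type*} [NormedAddCommGroup E] [NormedSpace ℂ E]
    [NormedAddCommGroup F] [NormedSpace ℂ F] [TopologicalSpace.SeparableSpace E]
    [TopologicalSpace.SeparableSpace F] : TopologicalSpace.SeparableSpace (WithLp 2 (E × F)) :=
  (WithLp.prodContinuousLinearEquiv 2 ℂ E F).symm.surjective.denseRange.separableSpace
    (WithLp.prodContinuousLinearEquiv 2 ℂ E F).symm.continuous

theorem KernelModel.exists_cowenDouglas_mulByCoord {V E H : Type*} [NormedAddCommGroup V]
    [InnerProductSpace ℂ V] [CompleteSpace V] [NormedAddCommGroup E] [InnerProductSpace ℂ E]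
    [CompleteSpace E] [TopologicalSpace.SeparableSpace E] [NormedAddCommGroup H]
    [InnerProductSpace ℂ H] [CompleteSpace H] [RKHS ℂ H 𝔻 V]
    {K : Matrix 𝔻 𝔻 (V →L[ℂ] V)} {k : 𝔻 → V →L[ℂ] E} (h : KernelModel K k)
    (hcov : IsMobiusCovariant K) (hK : RKHS.kernel H = K) {T : E →L[ℂ] E}
    (hT : ∀ w v, T (k w v) = conj (w : ℂ) • k w v) (hsurj : Function.Surjective T) {n : ℕ}
    (hn : 0 < n) (hker : Module.finrank ℂ (Module.End.eigenspace (T : E →ₗ[ℂ] E) 0) = n) :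
    ∃ M : H →L[ℂ] H, IsMulByCoord M ∧
      UnitarilyEquivalent (ContinuousLinearMap.adjoint M) T ∧
      (∀ w v, ContinuousLinearMap.adjoint M (RKHS.kerFun H w v) =
        conj (w : ℂ) • RKHS.kerFun H w v) ∧
      CowenDouglas n (Metric.ball 0 1) (ContinuousLinearMap.adjoint M) ∧
      IsHomogeneousOp (ContinuousLinearMap.adjoint M) := by
  have := h.separableSpace hK
  obtain ⟨M, hM, hMT, hMk⟩ := h.exists_mulByCoord hK hT
  have hm := kernelModel_kerFun H
  rw [hK] at hm
  exact ⟨M, hM, hMT, hMk,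
    hm.cowenDouglas hcov hMk (hMT.surjective hsurj) hn ((hMT.finrank_eigenspace 0).trans hker),
    (hm.isMobiusInvariant hcov hMk).isHomogeneousOp⟩

end Decomposition

end

/-! ### The theorem -/

theorem mainTheorem5 (α β γ : ℝ) (hα : 0 < α) (hβ : 0 < β) (hγ : 0 < γ) :
    -- the three functions are non-negative definite kernels, so the Hilbert spaces exist
    (tridiscJetKernel α β γ).PosSemidef ∧
    (bidiscJetKernel α (β + γ)).PosSemidef ∧
    (discKernel (α + β + γ + 2)).PosSemidef ∧
    -- `H`, `H₁`, `H₂` are the Hilbert spaces with these reproducing kernels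
    ∀ {H H₁ H₂ : Type*}
      [NormedAddCommGroup H] [InnerProductSpace ℂ H] [CompleteSpace H]
      [RKHS ℂ H 𝔻 (EuclideanSpace ℂ (Fin 3))]
      [NormedAddCommGroup H₁] [InnerProductSpace ℂ H₁] [CompleteSpace H₁]
      [RKHS ℂ H₁ 𝔻 (EuclideanSpace ℂ (Fin 2))]
      [NormedAddCommGroup H₂] [InnerProductSpace ℂ H₂] [CompleteSpace H₂]
      [RKHS ℂ H₂ 𝔻 ℂ],
      RKHS.kernel H = tridiscJetKernel α β γ →
      RKHS.kernel H₁ = bidiscJetKernel α (β + γ) →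
      RKHS.kernel H₂ = discKernel (α + β + γ + 2) →
      ConsistsOfHolomorphic H ∧ ConsistsOfHolomorphic H₁ ∧ ConsistsOfHolomorphic H₂ ∧
      -- the multiplication operators are well defined and bounded
      ∃ (M : H →L[ℂ] H) (M₁ : H₁ →L[ℂ] H₁) (M₂ : H₂ →L[ℂ] H₂),
        IsMulByCoord M ∧ IsMulByCoord M₁ ∧ IsMulByCoord M₂ ∧
        (CowenDouglas 3 (Metric.ball 0 1) (ContinuousLinearMap.adjoint M) ∧
          IsHomogeneousOp (ContinuousLinearMap.adjoint M) ∧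
          IsReducibleOp (ContinuousLinearMap.adjoint M)) ∧
        UnitarilyEquivalent (ContinuousLinearMap.adjoint M)
          (directSumOp (ContinuousLinearMap.adjoint M₁) (ContinuousLinearMap.adjoint M₂)) ∧
        (CowenDouglas 2 (Metric.ball 0 1) (ContinuousLinearMap.adjoint M₁) ∧
          IsHomogeneousOp (ContinuousLinearMap.adjoint M₁) ∧
          IsIrreducibleOp (ContinuousLinearMap.adjoint M₁)) ∧
        (CowenDouglas 1 (Metric.ball 0 1) (ContinuousLinearMap.adjoint M₂) ∧
          IsHomogeneousOp (ContinuousLinearMap.adjoint M₂) ∧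
          IsIrreducibleOp (ContinuousLinearMap.adjoint M₂)) := by
  have hβγ : 0 < β + γ := add_pos hβ hγ
  have ht : 0 < α + β + γ + 2 := by positivity
  have m₁ := kernelModel_bidiscJetKernel hα hβγ
  have m₂ := kernelModel_discKernel ht
  have m := m₁.directSum m₂ (jetSum β γ) (jetDifference β γ) (jet_surjective hβ hγ)
    (inner_tridiscJetKernel_eq_add hβ hγ α)
  refine ⟨m.posSemidef, m₁.posSemidef, m₂.posSemidef, ?_⟩
  intro H H₁ H₂ _ _ _ _ _ _ _ _ _ _ _ _ hH hH₁ hH₂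
  obtain ⟨T₁, hT₁, hs₁, hk₁⟩ := exists_bidiscBackward hα hβγ
  obtain ⟨T₂, hT₂', -, hs₂, hk₂⟩ := exists_backwardShift ht
  have hT₂ (w : 𝔻) (v : ℂ) : T₂ (ContinuousLinearMap.toSpanSingleton ℂ (discVec _ ht w) v) =
      conj (w : ℂ) • ContinuousLinearMap.toSpanSingleton ℂ (discVec _ ht w) v := by
    rw [ContinuousLinearMap.toSpanSingleton_apply, map_smul, hT₂', smul_comm]
  have f₁ := Module.finite_of_finrank_pos (two_pos.trans_eq hk₁.symm)
  have f₂ := Module.finite_of_finrank_pos (one_pos.trans_eq hk₂.symm)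
  obtain ⟨M, hM, hMT, -, hMB, hMh⟩ := m.exists_cowenDouglas_mulByCoord
    (isMobiusCovariant_tridiscJetKernel α β γ) hH (T := directSumOp T₁ T₂)
    (fun w v => (WithLp.linearEquiv 2 ℂ _).injective
      (Prod.ext (hT₁ w (jetSum β γ v)) (hT₂ w (jetDifference β γ v))))
    (directSumOp_surjective hs₁ hs₂) three_pos
    (by rw [finrank_eigenspace_directSumOp, hk₁, hk₂]; rfl)
  obtain ⟨M₁, hM₁, hMT₁, hMk₁, hMB₁, hMh₁⟩ := m₁.exists_cowenDouglas_mulByCoord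
    (isMobiusCovariant_bidiscJetKernel α (β + γ)) hH₁ hT₁ hs₁ two_pos hk₁
  obtain ⟨M₂, hM₂, hMT₂, hMk₂, hMB₂, hMh₂⟩ := m₂.exists_cowenDouglas_mulByCoord
    (isMobiusCovariant_discKernel _) hH₂ hT₂ hs₂ one_pos hk₂
  have n₁ := kernelModel_kerFun H₁
  have n₂ := kernelModel_kerFun H₂
  rw [hH₁] at n₁
  rw [hH₂] at n₂
  have hirr₁ := n₁.isIrreducibleOp (isMobiusCovariant_bidiscJetKernel α (β + γ)) hMk₁
    (by rw [hMT₁.finrank_eigenspace, hk₁, finrank_euclideanSpace_fin])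
    (bidiscJetKernel_diag_injective α hβγ) (bidiscJetKernel_commutant α hβγ)
  have hirr₂ := n₂.isIrreducibleOp (isMobiusCovariant_discKernel _) hMk₂
    (by rw [hMT₂.finrank_eigenspace, hk₂, Module.finrank_self])
    (discKernel_diag_injective _) (discKernel_commutant _)
  -- The adjoint of `M` is compared with those of `M₁` and `M₂` through the common model `T₁ ⊕ T₂`.
  have hsum := hMT.trans (directSumOp_unitarilyEquivalent hMT₁ hMT₂).symm
  have := hirr₁.1
  have := hirr₂.1
  refine ⟨m.consistsOfHolomorphic hH fun x v => ?_,
    m₁.consistsOfHolomorphic hH₁ (exists_holomorphic_inner_bidiscVec hα hβγ),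
    m₂.consistsOfHolomorphic hH₂ (exists_holomorphic_inner_discVec ht),
    M, M₁, M₂, hM, hM₁, hM₂,
    ⟨hMB, hMh, isReducibleOp_of_unitarilyEquivalent_directSumOp hsum⟩, hsum,
    ⟨hMB₁, hMh₁, hirr₁⟩, ⟨hMB₂, hMh₂, hirr₂⟩⟩
  obtain ⟨F₁, hF₁, hF₁'⟩ := exists_holomorphic_inner_bidiscVec hα hβγ x.fst (jetSum β γ v)
  obtain ⟨F₂, hF₂, hF₂'⟩ := exists_holomorphic_inner_discVec ht x.snd (jetDifference β γ v)
  exact ⟨fun z => F₁ z + F₂ z, hF₁.add hF₂, fun z => by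
    beta_reduce
    rw [hF₁', hF₂']
    rfl⟩
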